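/- Let $\Sigma$ and $\Gamma$ be finite alphabets and let $\#$ be a padding symbol outside $\Sigma\cup\Gamma$. If $f\colon\Sigma^*\to\Gamma^*$ is computable by an S-RASP program with minimum vector length $q$, then $f$ is computable, with the same minimum vector length $q$, by a masked average-hard attention transformer encoder with position encoding $i/n$, $(i/n)^2$, $1/(i+2)$. The terms are as follows. **S-RASP.** A program works with vectors of length $n$ of Booleans, of symbols from a finite alphabet $\Delta\supseteq\Sigma\cup\Gamma\cup\{\#\}$, or of integers in $\{0,\dots,n-1\}$. Initially there are the symbol vector $\mathit{in}$ (the input) and the integer vector $\mathit{pos}(i)=i$; a program is a finite sequence of definitions of new vectors together with a designated symbol vector $\mathit{out}$. Expressions are built from entries $P(i)$, $P(j)$ of earlier vectors and conditionals "$e_1$ if $c$ else $e_2$" (of every type); symbol constants; the integers $0,1$ with $+$ and $-$, where all integer values are clipped to $[0,n-1]$; and Boolean combinations of $\top$, $\bot$, equality of symbols, and comparisons $=,\ne,<,\le,>,\ge$ of integers, each comparison containing at most one of the variables $i,j$. A definition is one of: 1. a position-wise operation $P(i)=e$ with $e$ in the variable $i$; 2. leftmost or rightmost attention with mask $M(i,j)$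 among $\top$, $j<i$, $j\le i$, $j>i$, $j\ge i$, with predicate $S(i,j)$ a Boolean expression or a test $V_1(i)=V_2(j)$ of two earlier integer vectors, with value $V(j)$ and default $D(i)$ of the same type: $P(i)=V(j_i)$ for the least (resp. greatest) $j_i\in\{0,\dots,n-1\}$ satisfying $M(i,j_i)\wedge S(i,j_i)$, and $P(i)=D(i)$ if there is none; 3. a prefix sum $P(i)=\min\bigl(n-1,\sum_{j\le i}V(j)\bigr)$ of an integer expression $V(j)$. The program computes $f$ with minimum vector length $q\colon\mathbb N\to\mathbb N$ if $q$ is nondecreasing and, for every $w\in\Sigma^*$ of length $\ell$, $|f(w)|\le q(\ell)$ and, for every $n>\max(\ell,q(\ell))$, the program run on $w\#^{n-\ell}$ has output vector $f(w)\#^{n-|f(w)|}$. **Transformers.** An activation sequence consists of vectors $u_{-1},u_0,\dots,u_{n-1}\in\mathbb R^d$. A transformer encoder is a finite sequence of layers acting on activation sequences; the dimension, the layers and their parameters do not depend on $n$. A layer is either position-wise, $u_i'=u_i+W_2\,\mathrm{ReLU}(W_1u_i+b_1)+b_2$, or an average-hard attention layer given by linear maps $Q,K,V\colon\mathbb R^d\to\mathbb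 R^d$ and a mask (none, $j<i$, or $j\le i$): $u_i'=u_i+\frac1{|M_i|}\sum_{j\in M_i}Vu_j$, where $M_i$ is the set of allowed positions $j$ that maximize $\langle Qu_i,Ku_j\rangle$ (and $u_i'=u_i$ if no position is allowed). On the padded input $a_0\cdots a_{n-1}=w\#^{n-\ell}$, the initial vector $u_i$ holds, in fixed distinct coordinates, the one-hot encoding of $a_i\in\Sigma\cup\{\#\}$ (the zero vector for $i=-1$) and the three numbers $i/n$, $(i/n)^2$, $1/(i+2)$; all other coordinates are $0$. The transformer computes $f$ with minimum vector length $q$ if $q$ is nondecreasing and, for every $w\in\Sigma^*$ of length $\ell$, $|f(w)|\le q(\ell)$ and, for every $n>\max(\ell,q(\ell))$, designated fixed coordinates of the final activation sequence hold the one-hot encoding over $\Gamma\cup\{\#\}$ of $f(w)\#^{n-|f(w)|}$ (the zero vector at position $-1$). -/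

import Mathlib

/-- The padded vector of length `n` holding the string `w`: position `i` carries the `i`-th symbol
of `w`, or the padding symbol, represented by `none`, if `i` is at or beyond the end of `w`. -/
def paddedVector {A : Type*} (w : List A) (n : ℕ) : Fin n → Option A :=
  fun i => w[(i : ℕ)]?

namespace SRASP

/-- The three types of values: Booleans, symbols, and integers in `{0, ..., n-1}`. -/
inductive Ty where
  | bool
  | sym
  | nat

/-- Values of each type, over the symbol alphabet `Δ`. Integer values are kept in
`{0, ..., n-1}` by clipping. -/
abbrev Ty.Val (Δ : Type) : Ty → Type
  | .bool => Bool
  | .sym => Δ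
  | .nat => ℕ

/-- The position variables `i` and `j`. -/
inductive PVar where
  | i
  | j

/-- Names of the vectors of type `τ` among those declared in a context. -/
inductive Vec : List Ty → Ty → Type where
  | here {ctx : List Ty} {τ : Ty} : Vec (τ :: ctx) τ
  | there {ctx : List Ty} {σ τ : Ty} : Vec ctx τ → Vec (σ :: ctx) τ

/-- Comparison operators on integers. -/
inductive Cmp where
  | eq
  | ne
  | lt
  | le
  | gt
  | ge

def Cmp.eval : Cmp → ℕ → ℕ → Bool
  | .eq, a, b => decide (a = b)
  | .ne, a, b => decide (a ≠ b)
  | .lt, a, b => decide (a < b)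
  | .le, a, b => decide (a ≤ b)
  | .gt, a, b => decide (a > b)
  | .ge, a, b => decide (a ≥ b)

/-- Expressions of Boolean, symbol and integer type over previously defined vectors. -/
inductive Expr (Δ : Type) (ctx : List Ty) : Ty → Type where
  | vec {τ : Ty} (P : Vec ctx τ) (x : PVar) : Expr Δ ctx τ
  /-- `ite e₁ c e₂` is the conditional expression "`e₁` if `c` else `e₂`". -/
  | ite {τ : Ty} (e₁ : Expr Δ ctx τ) (c : Expr Δ ctx .bool) (e₂ : Expr Δ ctx τ) : Expr Δ ctx τ
  | top : Expr Δ ctx .bool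
  | bot : Expr Δ ctx .bool
  | and (e₁ e₂ : Expr Δ ctx .bool) : Expr Δ ctx .bool
  | or (e₁ e₂ : Expr Δ ctx .bool) : Expr Δ ctx .bool
  | not (e : Expr Δ ctx .bool) : Expr Δ ctx .bool
  | symEq (e₁ e₂ : Expr Δ ctx .sym) : Expr Δ ctx .bool
  | cmp (op : Cmp) (e₁ e₂ : Expr Δ ctx .nat) : Expr Δ ctx .bool
  | sym (a : Δ) : Expr Δ ctx .sym
  | zero : Expr Δ ctx .nat
  | one : Expr Δ ctx .nat
  | add (e₁ e₂ : Expr Δ ctx .nat) : Expr Δ ctx .nat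
  | sub (e₁ e₂ : Expr Δ ctx .nat) : Expr Δ ctx .nat

/-- The set of position variables occurring in an expression. -/
def Expr.FV {Δ : Type} {ctx : List Ty} : {τ : Ty} → Expr Δ ctx τ → Set PVar
  | _, .vec _ x => {x}
  | _, .ite e₁ c e₂ => e₁.FV ∪ c.FV ∪ e₂.FV
  | _, .top => ∅
  | _, .bot => ∅
  | _, .and e₁ e₂ => e₁.FV ∪ e₂.FV
  | _, .or e₁ e₂ => e₁.FV ∪ e₂.FV
  | _, .not e => e.FV
  | _, .symEq e₁ e₂ => e₁.FV ∪ e₂.FV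
  | _, .cmp _ e₁ e₂ => e₁.FV ∪ e₂.FV
  | _, .sym _ => ∅
  | _, .zero => ∅
  | _, .one => ∅
  | _, .add e₁ e₂ => e₁.FV ∪ e₂.FV
  | _, .sub e₁ e₂ => e₁.FV ∪ e₂.FV

/-- Every integer comparison inside the expression involves at most one position variable. -/
def Expr.UnaryComparisons {Δ : Type} {ctx : List Ty} : {τ : Ty} → Expr Δ ctx τ → Prop
  | _, .vec _ _ => True
  | _, .ite e₁ c e₂ => e₁.UnaryComparisons ∧ c.UnaryComparisons ∧ e₂.UnaryComparisons
  | _, .top => True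
  | _, .bot => True
  | _, .and e₁ e₂ => e₁.UnaryComparisons ∧ e₂.UnaryComparisons
  | _, .or e₁ e₂ => e₁.UnaryComparisons ∧ e₂.UnaryComparisons
  | _, .not e => e.UnaryComparisons
  | _, .symEq e₁ e₂ => e₁.UnaryComparisons ∧ e₂.UnaryComparisons
  | _, .cmp op e₁ e₂ =>
      (Expr.cmp op e₁ e₂).FV.Subsingleton ∧ e₁.UnaryComparisons ∧ e₂.UnaryComparisons
  | _, .sym _ => True
  | _, .zero => True
  | _, .one => True
  | _, .add e₁ e₂ => e₁.UnaryComparisons ∧ e₂.UnaryComparisons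
  | _, .sub e₁ e₂ => e₁.UnaryComparisons ∧ e₂.UnaryComparisons

/-- The values of all declared vectors, at vector length `n`. -/
def Env (Δ : Type) (n : ℕ) (ctx : List Ty) : Type :=
  (τ : Ty) → Vec ctx τ → Fin n → τ.Val Δ

def Env.nil {Δ : Type} {n : ℕ} : Env Δ n [] :=
  fun _ P => nomatch P

def Env.cons {Δ : Type} {n : ℕ} {ctx : List Ty} {σ : Ty} (v : Fin n → σ.Val Δ)
    (ρ : Env Δ n ctx) : Env Δ n (σ :: ctx)
  | _, .here => v
  | _, .there P => ρ _ P

/-- The value of an expression at vector length `n`, for given positions `i` and `j`. Integer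
values less than `0` are replaced by `0`, values greater than `n - 1` by `n - 1`. -/
def Expr.eval {Δ : Type} [DecidableEq Δ] {n : ℕ} {ctx : List Ty} (ρ : Env Δ n ctx) (i j : Fin n) :
    {τ : Ty} → Expr Δ ctx τ → τ.Val Δ
  | τ, .vec P .i => ρ τ P i
  | τ, .vec P .j => ρ τ P j
  | _, .ite e₁ c e₂ => bif (c.eval ρ i j : Bool) then e₁.eval ρ i j else e₂.eval ρ i j
  | _, .top => true
  | _, .bot => false
  | _, .and e₁ e₂ => Bool.and (e₁.eval ρ i j) (e₂.eval ρ i j)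
  | _, .or e₁ e₂ => Bool.or (e₁.eval ρ i j) (e₂.eval ρ i j)
  | _, .not e => Bool.not (e.eval ρ i j)
  | _, .symEq e₁ e₂ => decide ((e₁.eval ρ i j : Δ) = (e₂.eval ρ i j : Δ))
  | _, .cmp op e₁ e₂ => op.eval (e₁.eval ρ i j) (e₂.eval ρ i j)
  | _, .sym a => a
  | _, .zero => (0 : ℕ)
  | _, .one => min (1 : ℕ) (n - 1)
  | _, .add e₁ e₂ => min ((e₁.eval ρ i j : ℕ) + (e₂.eval ρ i j : ℕ)) (n - 1)
  | _, .sub e₁ e₂ => (e₁.eval ρ i j : ℕ) - (e₂.eval ρ i j : ℕ)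

/-- The choice function of an attention operation. -/
inductive Choice where
  | leftmost
  | rightmost

/-- The mask predicates `⊤`, `j < i`, `j ≤ i`, `j > i`, `j ≥ i`. -/
inductive Mask where
  | none
  | strictFuture
  | future
  | strictPast
  | past

def Mask.eval {n : ℕ} : Mask → Fin n → Fin n → Bool
  | .none, _, _ => true
  | .strictFuture, i, j => decide (j < i)
  | .future, i, j => decide (j ≤ i)
  | .strictPast, i, j => decide (j > i)
  | .past, i, j => decide (j ≥ i)

/-- Attention predicates `S(i,j)`: a Boolean expression (whose integer comparisons are unary), or
an equality test `V₁(i) = V₂(j)` of two integer vectors. -/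
inductive AttnPred (Δ : Type) (ctx : List Ty) where
  | expr (e : Expr Δ ctx .bool) (he : e.UnaryComparisons)
  | natEq (V₁ V₂ : Vec ctx .nat)

def AttnPred.eval {Δ : Type} [DecidableEq Δ] {n : ℕ} {ctx : List Ty} (ρ : Env Δ n ctx)
    (i j : Fin n) : AttnPred Δ ctx → Bool
  | .expr e _ => e.eval ρ i j
  | .natEq V₁ V₂ => decide ((ρ .nat V₁ i : ℕ) = (ρ .nat V₂ j : ℕ))

/-- Right-hand sides of definitions of vectors of type `τ`. -/
inductive Rhs (Δ : Type) (ctx : List Ty) : Ty → Type where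
  /-- A position-wise operation `P(i) = e`. -/
  | pointwise {τ : Ty} (e : Expr Δ ctx τ) (he : e.FV ⊆ {PVar.i}) : Rhs Δ ctx τ
  /-- Leftmost or rightmost attention with mask `M(i,j)`, attention predicate `S(i,j)`, value
  function `V(j)` and default function `D(i)`. -/
  | attention {τ : Ty} (choice : Choice) (M : Mask) (S : AttnPred Δ ctx)
      (V : Expr Δ ctx τ) (hV : V.FV ⊆ {PVar.j}) (D : Expr Δ ctx τ) (hD : D.FV ⊆ {PVar.i}) :
      Rhs Δ ctx τ
  /-- The prefix sum of `V(j)` over `j ≤ i`. -/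
  | prefixSum (V : Expr Δ ctx .nat) (hV : V.FV ⊆ {PVar.j}) : Rhs Δ ctx .nat

/-- The position selected from a set of candidates by a choice function, if there is any. -/
def Choice.select {n : ℕ} (c : Choice) (s : Finset (Fin n)) : Option (Fin n) :=
  if h : s.Nonempty then
    match c with
    | .leftmost => some (s.min' h)
    | .rightmost => some (s.max' h)
  else none

def Rhs.eval {Δ : Type} [DecidableEq Δ] {n : ℕ} {ctx : List Ty} (ρ : Env Δ n ctx) :
    {τ : Ty} → Rhs Δ ctx τ → Fin n → τ.Val Δ
  | _, .pointwise e _, i => e.eval ρ i i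
  | _, .attention choice M S V _ D _, i =>
      match choice.select (Finset.univ.filter fun j => M.eval i j = true ∧ S.eval ρ i j = true) with
      | some j => V.eval ρ j j
      | none => D.eval ρ i i
  | _, .prefixSum V _, i => min (∑ j ∈ Finset.Iic i, (V.eval ρ j j : ℕ)) (n - 1)

/-- Sequences of definitions. A context lists the types of the declared vectors, the most recent
one first; initially there are the input vector `in` and the position vector `pos`. -/
inductive Code (Δ : Type) : List Ty → Type where
  | start : Code Δ [.sym, .nat]
  | define {ctx : List Ty} {τ : Ty} (c : Code Δ ctx) (r : Rhs Δ ctx τ) : Code Δ (τ :: ctx)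

def Code.run {Δ : Type} [DecidableEq Δ] {n : ℕ} (input : Fin n → Δ) :
    {ctx : List Ty} → Code Δ ctx → Env Δ n ctx
  | _, .start => Env.cons (σ := .sym) input (Env.cons (σ := .nat) (fun i => (i : ℕ)) Env.nil)
  | _, .define c r => Env.cons (r.eval (c.run input)) (c.run input)

/-- An S-RASP program with input alphabet `A` and output alphabet `B`: a finite alphabet `Δ`
containing `A`, `B` and the padding symbol (which belongs to neither `A` nor `B`), a sequence of
definitions, and a designated output vector of symbols. -/
structure Program (A B : Type*) where
  Δ : Type
  [decEq : DecidableEq Δ]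
  [fin : Fintype Δ]
  inSym : Option A ↪ Δ
  outSym : Option B ↪ Δ
  pad_eq : inSym none = outSym none
  ctx : List Ty
  code : Code Δ ctx
  out : Vec ctx .sym

/-- The output vector of a program on the string `w` padded to length `n`. -/
def Program.output {A B : Type*} (P : Program A B) (w : List A) (n : ℕ) : Fin n → P.Δ :=
  letI := P.decEq
  P.code.run (fun i => P.inSym (paddedVector w n i)) .sym P.out

/-- The program computes the transduction `f` with minimum vector length `q`. -/
def Program.Computes {A B : Type*} (P : Program A B) (f : List A → List B) (q : ℕ → ℕ) : Prop :=
  Monotone q ∧ ∀ w : List A, (f w).length ≤ q w.length ∧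
    ∀ n : ℕ, w.length < n → q w.length < n →
      ∀ i : Fin n, P.output w n i = P.outSym (paddedVector (f w) n i)

end SRASP

namespace AHAT

/-- An activation sequence: the `n + 1` positions `-1, 0, ..., n-1` are numbered by
`p : Fin (n + 1)`, so that `p` stands for the position `p - 1`, and `0` is the default position. -/
abbrev Activation (d n : ℕ) : Type := Fin (n + 1) → Fin d → ℝ

/-- A two-layer feed-forward network with ReLU activations. -/
structure FFN (d : ℕ) where
  hidden : ℕ
  W₁ : Matrix (Fin hidden) (Fin d) ℝ
  b₁ : Fin hidden → ℝ
  W₂ : Matrix (Fin d) (Fin hidden) ℝ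
  b₂ : Fin d → ℝ

def FFN.eval {d : ℕ} (N : FFN d) (x : Fin d → ℝ) : Fin d → ℝ :=
  N.W₂.mulVec (fun h => max 0 (N.W₁.mulVec x h + N.b₁ h)) + N.b₂

/-- No masking, strict future masking, and non-strict future masking. -/
inductive Mask where
  | none
  | strictFuture
  | future

/-- Position `p` may attend to position `r`. -/
def Mask.Allows {n : ℕ} : Mask → Fin (n + 1) → Fin (n + 1) → Prop
  | .none, _, _ => True
  | .strictFuture, p, r => r < p
  | .future, p, r => r ≤ p

/-- An average-hard attention layer. -/
structure Attention (d : ℕ) where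
  mask : Mask
  Q : (Fin d → ℝ) →ₗ[ℝ] (Fin d → ℝ)
  K : (Fin d → ℝ) →ₗ[ℝ] (Fin d → ℝ)
  V : (Fin d → ℝ) →ₗ[ℝ] (Fin d → ℝ)

def Attention.score {d n : ℕ} (L : Attention d) (u : Activation d n) (p r : Fin (n + 1)) : ℝ :=
  L.Q (u p) ⬝ᵥ L.K (u r)

open Classical in
/-- The allowed positions that maximize the attention score from position `p`. -/
noncomputable def Attention.maximizers {d n : ℕ} (L : Attention d) (u : Activation d n)
    (p : Fin (n + 1)) : Finset (Fin (n + 1)) :=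
  Finset.univ.filter fun r => L.mask.Allows p r ∧
    ∀ r', L.mask.Allows p r' → L.score u p r' ≤ L.score u p r

/-- The average is zero when there is no allowed position, which happens only at the default
position under strict future masking. -/
noncomputable def Attention.eval {d n : ℕ} (L : Attention d) (u : Activation d n) :
    Activation d n :=
  fun p => u p + ((L.maximizers u p).card : ℝ)⁻¹ • ∑ r ∈ L.maximizers u p, L.V (u r)

inductive Layer (d : ℕ) where
  | ffn (N : FFN d)
  | attention (L : Attention d)

noncomputable def Layer.eval {d n : ℕ} : Layer d → Activation d n → Activation d n
  | .ffn N, u => fun p => u p + N.eval (u p)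
  | .attention L, u => L.eval u

/-- The position encoding `i/n`, `(i/n)^2`, `1/(i+2)` of the position `i = p - 1`. -/
noncomputable def positionEncoding (n : ℕ) (p : Fin (n + 1)) : Fin 3 → ℝ :=
  let i : ℝ := (p : ℝ) - 1
  ![i / n, (i / n) ^ 2, 1 / (i + 2)]

open Classical in
/-- The one-hot encoding of a padded vector, with the zero vector at the default position. -/
noncomputable def oneHot {A : Type*} {n : ℕ} (s : Fin n → Option A) (p : Fin (n + 1))
    (a : Option A) : ℝ :=
  if ∃ i : Fin n, p = i.succ ∧ s i = a then 1 else 0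

/-- A masked average-hard attention transformer encoder with input alphabet `A` and output alphabet
`B`: the dimension, the coordinates holding the one-hot encoding of the input and the three
components of the position encoding, the coordinates holding the one-hot encoding of the output,
and the layers, from first to last. None of these depends on the length of the input. -/
structure Encoder (A B : Type*) where
  d : ℕ
  inCoord : Option A ⊕ Fin 3 ↪ Fin d
  outCoord : Option B ↪ Fin d
  layers : List (Layer d)

/-- The initial activation sequence on the string `w` padded to length `n`; all coordinates not
used for the input and the position encoding are zero. -/
noncomputable def Encoder.initial {A B : Type*} (T : Encoder A B) (w : List A) (n : ℕ) :
    Activation T.d n :=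
  fun p => Function.extend T.inCoord
    (Sum.elim (oneHot (paddedVector w n) p) (positionEncoding n p)) 0

noncomputable def Encoder.final {A B : Type*} (T : Encoder A B) (w : List A) (n : ℕ) :
    Activation T.d n :=
  T.layers.foldl (fun u L => L.eval u) (T.initial w n)

/-- The transformer encoder computes the transduction `f` with minimum vector length `q`. -/
def Encoder.Computes {A B : Type*} (T : Encoder A B) (f : List A → List B) (q : ℕ → ℕ) : Prop :=
  Monotone q ∧ ∀ w : List A, (f w).length ≤ q w.length ∧
    ∀ n : ℕ, w.length < n → q w.length < n →
      ∀ (p : Fin (n + 1)) (b : Option B),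
        T.final w n p (T.outCoord b) = oneHot (paddedVector (f w) n) p b

end AHAT

/-!
A program is translated definition by definition, keeping every vector available at every position
of the activations: Booleans as `0` and `1`, symbols as one-hot vectors, integers divided by `n`.

A transformer can always be given one more coordinate, unused by its layers, and a layer that
writes only there. Hence it suffices to work with the closure of the initial activations under
affine combinations, rectification and average-hard attention with bilinear scores
(`Realizable`, `Realizable.addable`), as one works with measurable functions. Vectors over
`0, ..., n-1` are extended by `0` to the default position, whose indicator is available because
`1/(i+2)` is `1` there and at most `1/2` elsewhere. In an attention layer the default position
can be given a score of its own for each query position (`RealizableVec.attend`), and everything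
else is a choice of scores:

* Letting the default position compete with the score `a(i)` against scores `0` tests the sign of
  `a(i)`. Applied to `(x - y - 1/2)/n`, this compares integers (`RealizableVal.le`).
* The score `2xj - j² = x² - (x - j)²` retrieves a value at position `x(i)`
  (`RealizableVec.lookup`). This needs the component `(i/n)²` of the position encoding. The score
  may carry a positive factor depending on `i`: uniform attention gives the mean of a vector over
  `-1, ..., i`, which is the prefix sum times `1/(i+2)`, and the sum is then recovered by a lookup
  with the factor `1/(i+2)` (`RealizableVal.prefixSum`).
* A Boolean expression in `i` and `j` with unary comparisons is a linear combination of products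
  of a Boolean depending on `i` and a Boolean depending on `j` (`PairRealizable.expr`), so its truth
  value is itself a bilinear score. The test `x(i) = y(j)` has the score `(2xy - y²)/n²`. In both
  cases the score separates candidates from other positions by a gap known at `i`
  (`Separable`), so that a small multiple of `j/n` selects the leftmost or rightmost
  candidate, while the default position, with a score inside the gap, wins if there is none
  (`Separable.attend`).
* Masks `j > i` and `j ≥ i` become masks `j < i` and `j ≤ i` when all vectors are reversed, and
  reversal is a lookup at position `n - 1 - i` (`Separable.attend_rev`).
-/

/-! ### Networks and their extensions -/

namespace AHAT

/-- A real value at every position, including the default position, for every input string and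
every vector length. -/
abbrev Family (A : Type*) : Type _ := (w : List A) → (n : ℕ) → Fin (n + 1) → ℝ

/-- A transformer encoder without designated output coordinates. -/
structure Network (A : Type*) where
  d : ℕ
  inCoord : Option A ⊕ Fin 3 ↪ Fin d
  layers : List (Layer d)

noncomputable def Network.initial {A : Type*} (T : Network A) (w : List A) (n : ℕ) :
    Activation T.d n :=
  fun p => Function.extend T.inCoord
    (Sum.elim (oneHot (paddedVector w n) p) (positionEncoding n p)) 0

noncomputable def Network.final {A : Type*} (T : Network A) (w : List A) (n : ℕ) :
    Activation T.d n :=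
  T.layers.foldl (fun u L => L.eval u) (T.initial w n)

/-- Coordinate `c` of the network computes the family `g`. The vector length `0`, which never
occurs in a computation, is left out. -/
def Network.Holds {A : Type*} (T : Network A) (c : Fin T.d) (g : Family A) : Prop :=
  ∀ w n, 0 < n → ∀ p, T.final w n p c = g w n p

/-- Append one coordinate to every vector of an activation sequence. -/
def snocCoord {d n : ℕ} (u : Activation d n) (x : Fin (n + 1) → ℝ) : Activation (d + 1) n :=
  fun p => Fin.snoc (u p) (x p)

@[simp] lemma snocCoord_castSucc {d n : ℕ} (u : Activation d n) (x : Fin (n + 1) → ℝ)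
    (p : Fin (n + 1)) (c : Fin d) : snocCoord u x p c.castSucc = u p c := by
  simp [snocCoord]

@[simp] lemma snocCoord_last {d n : ℕ} (u : Activation d n) (x : Fin (n + 1) → ℝ)
    (p : Fin (n + 1)) : snocCoord u x p (Fin.last d) = x p := by
  simp [snocCoord]

/-- The projection that forgets the last coordinate. -/
def dropLast (d : ℕ) : (Fin (d + 1) → ℝ) →ₗ[ℝ] (Fin d → ℝ) :=
  LinearMap.funLeft ℝ ℝ Fin.castSucc

/-- The inclusion that sets the last coordinate to zero. -/
def appendZero (d : ℕ) : (Fin d → ℝ) →ₗ[ℝ] (Fin (d + 1) → ℝ) where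
  toFun x := Fin.snoc x 0
  map_add' x y := by
    ext c
    refine Fin.lastCases ?_ (fun c => ?_) c <;> simp
  map_smul' a x := by
    ext c
    refine Fin.lastCases ?_ (fun c => ?_) c <;> simp

lemma dropLast_snocCoord {d n : ℕ} (u : Activation d n) (x : Fin (n + 1) → ℝ)
    (p : Fin (n + 1)) : dropLast d (snocCoord u x p) = u p := by
  ext c
  simp [dropLast, LinearMap.funLeft]

@[simp] lemma appendZero_castSucc {d : ℕ} (x : Fin d → ℝ) (c : Fin d) :
    appendZero d x c.castSucc = x c := by
  simp [appendZero]

@[simp] lemma appendZero_last {d : ℕ} (x : Fin d → ℝ) : appendZero d x (Fin.last d) = 0 := by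
  simp [appendZero]

/-- A feed-forward network acting on the first `d` coordinates only. -/
def FFN.lift {d : ℕ} (N : FFN d) : FFN (d + 1) where
  hidden := N.hidden
  W₁ := Matrix.of fun h => Fin.snoc (N.W₁ h) 0
  b₁ := N.b₁
  W₂ := Matrix.of fun c h => (Fin.snoc (fun c => N.W₂ c h) 0 : Fin (d + 1) → ℝ) c
  b₂ := Fin.snoc N.b₂ 0

/-- An attention layer acting on the first `d` coordinates only. -/
def Attention.lift {d : ℕ} (L : Attention d) : Attention (d + 1) where
  mask := L.mask
  Q := appendZero d ∘ₗ L.Q ∘ₗ dropLast d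
  K := appendZero d ∘ₗ L.K ∘ₗ dropLast d
  V := appendZero d ∘ₗ L.V ∘ₗ dropLast d

def Layer.lift {d : ℕ} : Layer d → Layer (d + 1)
  | .ffn N => .ffn N.lift
  | .attention L => .attention L.lift

lemma FFN.lift_eval {d : ℕ} (N : FFN d) (x : Fin d → ℝ) (a : ℝ) :
    N.lift.eval (Fin.snoc x a) = Fin.snoc (N.eval x) 0 := by
  have h₁ : ∀ h, (Matrix.of fun h => (Fin.snoc (N.W₁ h) 0 : Fin (d + 1) → ℝ)).mulVec
      (Fin.snoc x a) h = N.W₁.mulVec x h := by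
    intro h
    simp [Matrix.mulVec, dotProduct, Fin.sum_univ_castSucc]
  ext c
  refine Fin.lastCases ?_ (fun c => ?_) c
  · simp [FFN.eval, FFN.lift, Matrix.mulVec, dotProduct]
  · simp only [FFN.eval, FFN.lift, Pi.add_apply, Fin.snoc_castSucc, h₁]
    simp [Matrix.mulVec, dotProduct]
    rfl

lemma Attention.lift_score {d n : ℕ} (L : Attention d) (u : Activation d n)
    (x : Fin (n + 1) → ℝ) (p r : Fin (n + 1)) :
    L.lift.score (snocCoord u x) p r = L.score u p r := by
  simp [Attention.score, Attention.lift, dropLast_snocCoord, dotProduct, Fin.sum_univ_castSucc]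

lemma Attention.lift_maximizers {d n : ℕ} (L : Attention d) (u : Activation d n)
    (x : Fin (n + 1) → ℝ) (p : Fin (n + 1)) :
    L.lift.maximizers (snocCoord u x) p = L.maximizers u p := by
  ext r
  simp only [Attention.maximizers, Finset.mem_filter, Attention.lift_score]
  rfl

lemma Layer.lift_eval {d n : ℕ} (L : Layer d) (u : Activation d n) :
    L.lift.eval (snocCoord u 0) = snocCoord (L.eval u) 0 := by
  cases L with
  | ffn N =>
    funext p
    show snocCoord u 0 p + N.lift.eval (Fin.snoc (u p) _) = _
    rw [FFN.lift_eval]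
    ext c
    refine Fin.lastCases ?_ (fun c => ?_) c <;> simp [Layer.eval]
  | attention L =>
    funext p
    show snocCoord u 0 p + ((L.lift.maximizers (snocCoord u 0) p).card : ℝ)⁻¹ •
      ∑ r ∈ L.lift.maximizers (snocCoord u 0) p, L.lift.V (snocCoord u 0 r) = _
    rw [Attention.lift_maximizers]
    ext c
    refine Fin.lastCases ?_ (fun c => ?_) c <;>
      simp [Layer.eval, Attention.eval, Attention.lift, dropLast_snocCoord]

/-- Add one coordinate, which is not used by the existing layers, and append a layer. -/
def Network.snocLayer {A : Type*} (T : Network A) (L : Layer (T.d + 1)) : Network A where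
  d := T.d + 1
  inCoord := T.inCoord.trans Fin.castSuccEmb
  layers := T.layers.map Layer.lift ++ [L]

lemma Network.snocLayer_initial {A : Type*} (T : Network A) (L : Layer (T.d + 1))
    (w : List A) (n : ℕ) : (T.snocLayer L).initial w n = snocCoord (T.initial w n) 0 := by
  funext p
  have hinj : Function.Injective ⇑(T.inCoord.trans Fin.castSuccEmb) :=
    (T.inCoord.trans Fin.castSuccEmb).injective
  show Function.extend ⇑(T.inCoord.trans Fin.castSuccEmb) _ 0 = _
  ext c
  refine Fin.lastCases ?_ (fun c => ?_) c
  · rw [Function.extend_apply']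
    · simp only [snocCoord_last]
      rfl
    · rintro ⟨a, ha⟩
      exact (Fin.castSucc_lt_last _).ne ha
  · rw [snocCoord_castSucc]
    by_cases hc : ∃ a, T.inCoord a = c
    · obtain ⟨a, rfl⟩ := hc
      have := hinj.extend_apply
        (Sum.elim (oneHot (paddedVector w n) p) (positionEncoding n p)) 0 a
      refine this.trans ?_
      exact (T.inCoord.injective.extend_apply _ _ a).symm
    · rw [Function.extend_apply', Network.initial, Function.extend_apply' _ _ _ hc]
      · rfl
      · rintro ⟨a, ha⟩
        exact hc ⟨a, Fin.castSucc_injective _ ha⟩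

lemma Network.snocLayer_final {A : Type*} (T : Network A) (L : Layer (T.d + 1))
    (w : List A) (n : ℕ) :
    (T.snocLayer L).final w n = L.eval (snocCoord (T.final w n) 0) := by
  have key : ∀ (l : List (Layer T.d)) (u : Activation T.d n),
      (l.map Layer.lift).foldl (fun u L => L.eval u) (snocCoord u 0)
        = snocCoord (l.foldl (fun u L => L.eval u) u) 0 := by
    intro l
    induction l with
    | nil => intro u; rfl
    | cons L l ih => intro u; simp only [List.map_cons, List.foldl_cons, Layer.lift_eval, ih]
  have h : (T.snocLayer L).final w n
      = (T.layers.map Layer.lift ++ [L]).foldl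
        (fun (u : Activation (T.d + 1) n) (L : Layer (T.d + 1)) => L.eval u)
        (snocCoord (T.initial w n) 0) :=
    congrArg (fun u : Activation (T.d + 1) n => (T.layers.map Layer.lift ++ [L]).foldl
      (fun (u : Activation (T.d + 1) n) (L : Layer (T.d + 1)) => L.eval u) u)
      (T.snocLayer_initial L w n)
  rw [h, List.foldl_append, key]
  rfl

/-- `T'` extends `T` if every coordinate of `T` has a counterpart in `T'` with the same final
values. The embedding is kept explicit so that coordinates added later are known to be new. -/
def Network.ExtendsBy {A : Type*} (T' T : Network A) (e : Fin T.d ↪ Fin T'.d) : Prop :=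
  ∀ w n p c, T'.final w n p (e c) = T.final w n p c

lemma Network.ExtendsBy.holds {A : Type*} {T' T : Network A} {e : Fin T.d ↪ Fin T'.d}
    (h : T'.ExtendsBy T e) {c : Fin T.d} {g : Family A} (hc : T.Holds c g) :
    T'.Holds (e c) g :=
  fun w n hn p => (h w n p c).trans (hc w n hn p)

lemma Network.ExtendsBy.trans {A : Type*} {T'' T' T : Network A} {e : Fin T.d ↪ Fin T'.d}
    {e' : Fin T'.d ↪ Fin T''.d} (h' : T''.ExtendsBy T' e') (h : T'.ExtendsBy T e) :
    T''.ExtendsBy T (e.trans e') :=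
  fun w n p c => (h' w n p (e c)).trans (h w n p c)

/-- The layers of the network preserve the input: the symbols and the position encoding are
available in the final activations. -/
def Network.KeepsInput {A : Type*} (T : Network A) : Prop :=
  ∀ x : Option A ⊕ Fin 3, ∃ c, T.Holds c fun w n p =>
    Sum.elim (oneHot (paddedVector w n) p) (positionEncoding n p) x

lemma Network.ExtendsBy.keepsInput {A : Type*} {T' T : Network A} {e : Fin T.d ↪ Fin T'.d}
    (h : T'.ExtendsBy T e) (hT : T.KeepsInput) : T'.KeepsInput := by
  intro x
  obtain ⟨c, hc⟩ := hT x
  exact ⟨e c, h.holds hc⟩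

/-- Every network that keeps its input can be extended so as to compute `g` in a new coordinate. -/
def Addable {A : Type*} (g : Family A) : Prop :=
  ∀ T : Network A, T.KeepsInput → ∃ (T' : Network A) (e : Fin T.d ↪ Fin T'.d) (c : Fin T'.d),
    T'.ExtendsBy T e ∧ c ∉ Set.range e ∧ T'.Holds c g

/-- Finitely many addable families can be added together, in distinct new coordinates.
Distinctness is what makes an embedding of the output alphabet. -/
lemma Addable.finset {A : Type*} {ι : Type*} [DecidableEq ι] {g : ι → Family A}
    (hg : ∀ l, Addable (g l)) (T : Network A) (hT : T.KeepsInput)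
    (s : Finset ι) :
    ∃ (T' : Network A) (e : Fin T.d ↪ Fin T'.d) (c : ι → Fin T'.d),
      T'.ExtendsBy T e ∧ Set.InjOn c s ∧ ∀ l ∈ s, c l ∉ Set.range e ∧ T'.Holds (c l) (g l) := by
  induction s using Finset.induction_on with
  | empty =>
    exact ⟨T, .refl _, fun _ => T.inCoord (.inr 0), fun _ _ _ _ => rfl, by simp, by simp⟩
  | insert a s ha ih =>
    obtain ⟨T₁, e₁, c₁, h₁, hinj, hc₁⟩ := ih
    obtain ⟨T₂, e₂, c₂, h₂, hc₂, hg₂⟩ := hg a T₁ (h₁.keepsInput hT)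
    have hne : ∀ l ∈ s, l ≠ a := fun l hl hla => ha (hla ▸ hl)
    refine ⟨T₂, e₁.trans e₂, Function.update (e₂ ∘ c₁) a c₂, h₂.trans h₁, ?_, ?_⟩
    · rw [Finset.coe_insert, Set.injOn_insert (by simpa using ha)]
      constructor
      · intro x hx y hy hxy
        rw [Function.update_of_ne (hne x hx), Function.update_of_ne (hne y hy)] at hxy
        exact hinj hx hy (e₂.injective hxy)
      · rintro ⟨l, hl, hla⟩
        rw [Function.update_self, Function.update_of_ne (hne l hl)] at hla
        exact hc₂ ⟨_, hla⟩
    · intro l hl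
      by_cases hla : l = a
      · subst hla
        rw [Function.update_self]
        refine ⟨?_, hg₂⟩
        rintro ⟨x, hx⟩
        exact hc₂ ⟨e₁ x, hx⟩
      · rw [Function.update_of_ne hla]
        have hls : l ∈ s := (Finset.mem_insert.1 hl).resolve_left hla
        refine ⟨?_, h₂.holds (hc₁ l hls).2⟩
        rintro ⟨x, hx⟩
        exact (hc₁ l hls).1 ⟨x, e₂.injective hx⟩

/-- A layer that writes only to the last coordinate adds the family it computes there. -/
lemma Network.exists_extendsBy_of_layer {A : Type*} (T : Network A) (L : Layer (T.d + 1))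
    (g : Family A)
    (hL : ∀ w n p, L.eval (snocCoord (T.final w n) 0) p
      = Fin.snoc (T.final w n p) (L.eval (snocCoord (T.final w n) 0) p (Fin.last _)))
    (hg : ∀ w n, 0 < n → ∀ p, L.eval (snocCoord (T.final w n) 0) p (Fin.last _) = g w n p) :
    ∃ (T' : Network A) (e : Fin T.d ↪ Fin T'.d) (c : Fin T'.d),
      T'.ExtendsBy T e ∧ c ∉ Set.range e ∧ T'.Holds c g := by
  refine ⟨T.snocLayer L, Fin.castSuccEmb, Fin.last T.d, ?_, ?_, ?_⟩
  · intro w n p c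
    rw [T.snocLayer_final, hL]
    exact Fin.snoc_castSucc (α := fun _ => ℝ) _ _ _
  · rintro ⟨c, hc⟩
    exact (Fin.castSucc_lt_last c).ne hc
  · intro w n hn p
    rw [T.snocLayer_final]
    exact hg w n hn p

/-- A feed-forward layer can write any two-layer function of the existing coordinates to a new
coordinate. -/
lemma Network.exists_extendsBy_of_ffn {A : Type*} (T : Network A) (m : ℕ)
    (W : Fin m → Fin T.d → ℝ) (a : Fin m → ℝ) (b : ℝ) (g : Family A)
    (hg : ∀ w n, 0 < n → ∀ p, ∑ h, a h * max 0 (W h ⬝ᵥ T.final w n p) + b = g w n p) :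
    ∃ (T' : Network A) (e : Fin T.d ↪ Fin T'.d) (c : Fin T'.d),
      T'.ExtendsBy T e ∧ c ∉ Set.range e ∧ T'.Holds c g := by
  refine T.exists_extendsBy_of_layer (.ffn
    { hidden := m
      W₁ := Matrix.of fun h => Fin.snoc (W h) 0
      b₁ := 0
      W₂ := Matrix.of fun c h => (Fin.snoc 0 (a h) : Fin (T.d + 1) → ℝ) c
      b₂ := Fin.snoc 0 b }) g ?_ ?_
  · intro w n p
    ext c
    refine Fin.lastCases ?_ (fun c => ?_) c
    · simp
    · simp [Layer.eval, FFN.eval, Matrix.mulVec, dotProduct]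
  · intro w n hn p
    rw [← hg w n hn p]
    simp [Layer.eval, FFN.eval, Matrix.mulVec, dotProduct, Fin.sum_univ_castSucc]

/-! ### Realizable families -/

open Classical in
/-- The average of `v` over the allowed positions that maximize the score from position `p`. -/
noncomputable def hardAverage {n : ℕ} (M : Mask) (s : Fin (n + 1) → Fin (n + 1) → ℝ)
    (v : Fin (n + 1) → ℝ) (p : Fin (n + 1)) : ℝ :=
  ((Finset.univ.filter fun r => M.Allows p r ∧ ∀ r', M.Allows p r' → s p r' ≤ s p r).card : ℝ)⁻¹ *
    ∑ r ∈ Finset.univ.filter fun r => M.Allows p r ∧ ∀ r', M.Allows p r' → s p r' ≤ s p r, v r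

/-- The families obtained from the initial activations by affine combinations, rectification and
average-hard attention with bilinear scores. -/
inductive Realizable {A : Type*} : Family A → Prop where
  | symbol (a : Option A) : Realizable fun w n p => oneHot (paddedVector w n) p a
  | position (k : Fin 3) : Realizable fun _ n p => positionEncoding n p k
  | affine (a b c : ℝ) {g h : Family A} (hg : Realizable g) (hh : Realizable h) :
      Realizable fun w n p => a * g w n p + b * h w n p + c
  | relu {g : Family A} (hg : Realizable g) : Realizable fun w n p => max 0 (g w n p)
  | attention (M : Mask) {ι : Type} [Fintype ι] {q k : ι → Family A} {v : Family A}
      (hq : ∀ l, Realizable (q l)) (hk : ∀ l, Realizable (k l)) (hv : Realizable v) :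
      Realizable fun w n p => hardAverage M (fun p r => ∑ l, q l w n p * k l w n r) (v w n) p
  | congr {g h : Family A} (hg : Realizable g) (hgh : ∀ w n, 0 < n → g w n = h w n) :
      Realizable h

lemma Network.exists_extendsBy_affine {A : Type*} (T : Network A) (a b c : ℝ) {g h : Family A}
    {cg ch : Fin T.d} (hg : T.Holds cg g) (hh : T.Holds ch h) :
    ∃ (T' : Network A) (e : Fin T.d ↪ Fin T'.d) (c' : Fin T'.d), T'.ExtendsBy T e ∧
      c' ∉ Set.range e ∧ T'.Holds c' fun w n p => a * g w n p + b * h w n p + c := by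
  -- `x = max 0 x - max 0 (-x)`
  refine T.exists_extendsBy_of_ffn 2
    ![Pi.single cg a + Pi.single ch b, -(Pi.single cg a + Pi.single ch b)] ![1, -1] c _ ?_
  intro w n hn p
  simp only [Fin.sum_univ_two, Matrix.cons_val_zero, Matrix.cons_val_one, neg_dotProduct,
    add_dotProduct, single_dotProduct, hg w n hn p, hh w n hn p]
  rcases le_total 0 (a * g w n p + b * h w n p) with h | h
  · rw [max_eq_right h, max_eq_left (by linarith)]; ring
  · rw [max_eq_left h, max_eq_right (by linarith)]; ring

lemma Network.exists_extendsBy_attention {A : Type*} (T : Network A) (M : Mask) {ι : Type}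
    [Fintype ι] {q k : ι → Family A} {v : Family A} {cq ck : ι → Fin T.d} {cv : Fin T.d}
    (hq : ∀ l, T.Holds (cq l) (q l)) (hk : ∀ l, T.Holds (ck l) (k l)) (hv : T.Holds cv v) :
    ∃ (T' : Network A) (e : Fin T.d ↪ Fin T'.d) (c : Fin T'.d), T'.ExtendsBy T e ∧
      c ∉ Set.range e ∧ T'.Holds c fun w n p =>
        hardAverage M (fun p r => ∑ l, q l w n p * k l w n r) (v w n) p := by
  classical
  -- With the identity as query map, the key map can be chosen to produce any bilinear score.
  let L : Attention (T.d + 1) :=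
    { mask := M
      Q := LinearMap.id
      K := ∑ l, (LinearMap.single ℝ (fun _ => ℝ) (cq l).castSucc) ∘ₗ
        (LinearMap.proj (ck l).castSucc)
      V := (LinearMap.single ℝ (fun _ => ℝ) (Fin.last T.d)) ∘ₗ (LinearMap.proj cv.castSucc) }
  have hscore : ∀ w n, 0 < n → ∀ p r, L.score (snocCoord (T.final w n) 0) p r
      = ∑ l, q l w n p * k l w n r := by
    intro w n hn p r
    simp only [Attention.score, L, LinearMap.id_apply, LinearMap.sum_apply, dotProduct_sum,
      LinearMap.comp_apply, LinearMap.proj_apply, LinearMap.single_apply, dotProduct_single,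
      snocCoord_castSucc, hq _ w n hn p, hk _ w n hn r]
  refine T.exists_extendsBy_of_layer (.attention L) _ ?_ ?_
  · intro w n p
    ext c
    refine Fin.lastCases ?_ (fun c => ?_) c
    · simp
    · simp [Layer.eval, Attention.eval, L, Finset.sum_apply,
        (Fin.castSucc_lt_last c).ne]
  · intro w n hn p
    have hmax : L.maximizers (snocCoord (T.final w n) 0) p = Finset.univ.filter fun r =>
        M.Allows p r ∧ ∀ r', M.Allows p r' →
          ∑ l, q l w n p * k l w n r' ≤ ∑ l, q l w n p * k l w n r := by
      ext r
      simp only [Attention.maximizers, Finset.mem_filter, hscore w n hn]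
      rfl
    simp only [Layer.eval, Attention.eval, Pi.add_apply, snocCoord_last, Pi.zero_apply, zero_add,
      Pi.smul_apply, smul_eq_mul, Finset.sum_apply, hardAverage, hmax]
    congr 1
    refine Finset.sum_congr rfl fun r _ => ?_
    simp [L, hv w n hn r]

/-- Realizability is what networks can compute: every realizable family can be added to every
network. -/
theorem Realizable.addable {A : Type*} {g : Family A} (hg : Realizable g) : Addable g := by
  classical
  induction hg with
  | symbol a =>
    intro T hT
    obtain ⟨c, hc⟩ := hT (.inl a)
    obtain ⟨T', e, c', h, hc', hh⟩ := T.exists_extendsBy_affine 1 0 0 hc hc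
    exact ⟨T', e, c', h, hc', fun w n hn p => by simpa using hh w n hn p⟩
  | position k =>
    intro T hT
    obtain ⟨c, hc⟩ := hT (.inr k)
    obtain ⟨T', e, c', h, hc', hh⟩ := T.exists_extendsBy_affine 1 0 0 hc hc
    exact ⟨T', e, c', h, hc', fun w n hn p => by simpa using hh w n hn p⟩
  | affine a b c _ _ ihg ihh =>
    intro T hT
    obtain ⟨T₁, e₁, c₁, h₁, -, hg₁⟩ := ihg T hT
    obtain ⟨T₂, e₂, c₂, h₂, -, hg₂⟩ := ihh T₁ (h₁.keepsInput hT)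
    obtain ⟨T₃, e₃, c₃, h₃, hc₃, hg₃⟩ := T₂.exists_extendsBy_affine a b c (h₂.holds hg₁) hg₂
    exact ⟨T₃, (e₁.trans e₂).trans e₃, c₃, h₃.trans (h₂.trans h₁),
      fun ⟨x, hx⟩ => hc₃ ⟨_, hx⟩, hg₃⟩
  | @relu g _ ihg =>
    intro T hT
    obtain ⟨T₁, e₁, c₁, h₁, -, hg₁⟩ := ihg T hT
    obtain ⟨T₂, e₂, c₂, h₂, hc₂, hg₂⟩ := T₁.exists_extendsBy_of_ffn 1
      (fun _ => Pi.single c₁ 1) (fun _ => 1) 0 (fun w n p => max 0 (g w n p))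
      (fun w n hn p => by simp [hg₁ w n hn p])
    exact ⟨T₂, e₁.trans e₂, c₂, h₂.trans h₁, fun ⟨x, hx⟩ => hc₂ ⟨_, hx⟩, hg₂⟩
  | attention M _ _ _ ihq ihk ihv =>
    intro T hT
    obtain ⟨T₁, e₁, c₁, h₁, -, hg₁⟩ := Addable.finset ihq T hT Finset.univ
    obtain ⟨T₂, e₂, c₂, h₂, -, hg₂⟩ := Addable.finset ihk T₁ (h₁.keepsInput hT) Finset.univ
    obtain ⟨T₃, e₃, c₃, h₃, -, hg₃⟩ := ihv T₂ (h₂.keepsInput (h₁.keepsInput hT))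
    obtain ⟨T₄, e₄, c₄, h₄, hc₄, hg₄⟩ := T₃.exists_extendsBy_attention M
      (fun l => h₃.holds (h₂.holds (hg₁ l (Finset.mem_univ l)).2))
      (fun l => h₃.holds (hg₂ l (Finset.mem_univ l)).2) hg₃
    exact ⟨T₄, ((e₁.trans e₂).trans e₃).trans e₄, c₄, h₄.trans (h₃.trans (h₂.trans h₁)),
      fun ⟨x, hx⟩ => hc₄ ⟨_, hx⟩, hg₄⟩
  | congr _ hgh ih =>
    intro T hT
    obtain ⟨T₁, e₁, c₁, h₁, hc₁, hg₁⟩ := ih T hT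
    exact ⟨T₁, e₁, c₁, h₁, hc₁, fun w n hn p => by rw [hg₁ w n hn p, hgh w n hn]⟩

/-- If for every output symbol the corresponding coordinate of the one-hot encoding is
realizable, then the function is computed by an encoder. -/
theorem exists_encoder_of_realizable {A B : Type*} [Fintype A] [Fintype B]
    (g : Option B → Family A) (hg : ∀ b, Realizable (g b)) :
    ∃ T : Encoder A B, ∀ w n, 0 < n → ∀ p b, T.final w n p (T.outCoord b) = g b w n p := by
  classical
  let T₀ : Network A :=
    { d := Fintype.card (Option A ⊕ Fin 3)
      inCoord := (Fintype.equivFin _).toEmbedding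
      layers := [] }
  have hT₀ : T₀.KeepsInput := fun x =>
    ⟨T₀.inCoord x, fun w n _ p => T₀.inCoord.injective.extend_apply _ _ x⟩
  obtain ⟨T, e, c, -, hinj, hc⟩ := Addable.finset (fun b => (hg b).addable) T₀ hT₀ Finset.univ
  refine ⟨⟨T.d, T.inCoord, ⟨c, fun x y h => hinj (by simp) (by simp) h⟩, T.layers⟩, ?_⟩
  intro w n hn p b
  exact (hc b (Finset.mem_univ b)).2 w n hn p

end AHAT

/-! ### Realizable vectors -/

namespace AHAT

/-- A real vector of length `n` for every input string and every vector length `n`. -/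
abbrev VecFamily (A : Type*) : Type _ := (w : List A) → (n : ℕ) → Fin n → ℝ

/-- The vectors are realizable with the value `0` at the default position. -/
def RealizableVec {A : Type*} (v : VecFamily A) : Prop :=
  Realizable fun w n => (Fin.cons 0 (v w n) : Fin (n + 1) → ℝ)

lemma hardAverage_eq {n : ℕ} {M : Mask} {s : Fin (n + 1) → Fin (n + 1) → ℝ}
    {v : Fin (n + 1) → ℝ} {p : Fin (n + 1)} {x : ℝ} (hp : ∃ r, M.Allows p r)
    (hv : ∀ r, M.Allows p r → (∀ r', M.Allows p r' → s p r' ≤ s p r) → v r = x) :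
    hardAverage M s v p = x := by
  classical
  obtain ⟨r, hr, hmax⟩ := (Finset.univ.filter fun r => M.Allows p r).exists_max_image (s p)
    (hp.imp fun r hr => by simpa using hr)
  rw [hardAverage, Finset.sum_congr rfl fun r hr => hv r (Finset.mem_filter.1 hr).2.1
    (Finset.mem_filter.1 hr).2.2, Finset.sum_const, nsmul_eq_mul, ← mul_assoc, inv_mul_cancel₀,
    one_mul]
  refine Nat.cast_ne_zero.2 (Finset.card_ne_zero_of_mem (a := r) ?_)
  simp only [Finset.mem_filter, Finset.mem_univ, true_and] at hr hmax ⊢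
  exact ⟨hr, hmax⟩

lemma Realizable.const {A : Type*} (c : ℝ) : Realizable (A := A) fun _ _ _ => c :=
  (Realizable.affine 0 0 c (.position 0) (.position 0)).congr fun w n _ => by ext; simp

lemma positionEncoding_zero_two (n : ℕ) : positionEncoding n 0 2 = 1 := by
  show 1 / ((((0 : Fin (n + 1)) : ℕ) : ℝ) - 1 + 2) = 1
  norm_num

/-- The indicator of the default position. -/
lemma Realizable.default {A : Type*} :
    Realizable (A := A) fun _ _ p => if p = 0 then 1 else 0 := by
  -- The third component of the position encoding is `1` there and at most `1/2` elsewhere.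
  refine (Realizable.affine 2 0 (-1) (.position 2) (.position 2)).relu.congr fun w n _ => ?_
  ext p
  refine Fin.cases ?_ (fun i => ?_) p
  · simp only [positionEncoding_zero_two, if_true]
    norm_num
  · have h : (2 : ℝ) * (1 / ((i : ℝ) + 2)) ≤ 1 := by
      rw [mul_one_div, div_le_one (by positivity)]
      linarith [(Nat.cast_nonneg (i : ℕ) : (0 : ℝ) ≤ i)]
    have h' : ((i.succ : Fin (n + 1)) : ℝ) - 1 + 2 = (i : ℝ) + 2 := by
      push_cast [Fin.val_succ]; ring
    simp only [positionEncoding, Fin.succ_ne_zero, if_false, Matrix.cons_val, h', max_eq_left_iff]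
    linarith

/-- The value at the default position can be broadcast to all positions. -/
lemma Realizable.broadcast {A : Type*} {g : Family A} (hg : Realizable g) :
    Realizable fun w n _ => g w n 0 := by
  refine (Realizable.attention .none (ι := Unit) (fun _ => .const 1)
    (fun _ => Realizable.default) hg).congr fun w n _ => ?_
  ext p
  refine hardAverage_eq ⟨0, trivial⟩ fun r _ hr => ?_
  have := hr 0 trivial
  by_cases h : r = 0
  · rw [h]
  · norm_num [h] at this

namespace RealizableVec

variable {A : Type*}

lemma congr {u v : VecFamily A} (hu : RealizableVec u) (h : ∀ w n i, u w n i = v w n i) :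
    RealizableVec v := by
  have : u = v := by
    ext w n i
    exact h w n i
  exact this ▸ hu

/-- A realizable family can be replaced by zero at the default position if it is bounded there. -/
lemma of_realizable {g : Family A} (hg : Realizable g) (h : ∀ w n, 0 < n → |g w n 0| ≤ 1) :
    RealizableVec fun w n i => g w n i.succ := by
  refine (Realizable.affine 1 (-1) 0
    (Realizable.affine 1 (-1) 0 hg .default).relu
    (Realizable.affine (-1) (-1) 0 hg .default).relu).congr fun w n hn => ?_
  ext p
  refine Fin.cases ?_ (fun i => ?_) p
  · have := abs_le.1 (h w n hn)
    simp only [if_true, Fin.cons_zero]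
    rw [max_eq_left (by linarith), max_eq_left (by linarith)]
    ring
  · simp only [Fin.succ_ne_zero, if_false, Fin.cons_succ]
    rcases le_total 0 (g w n i.succ) with h | h
    · rw [max_eq_right (by linarith), max_eq_left (by linarith)]; ring
    · rw [max_eq_left (by linarith), max_eq_right (by linarith)]; ring

lemma linear (a b : ℝ) {u v : VecFamily A} (hu : RealizableVec u) (hv : RealizableVec v) :
    RealizableVec fun w n i => a * u w n i + b * v w n i := by
  refine (Realizable.affine a b 0 hu hv).congr fun w n _ => ?_
  ext p
  refine Fin.cases ?_ (fun i => ?_) p <;> simp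

lemma relu {v : VecFamily A} (hv : RealizableVec v) :
    RealizableVec fun w n i => max 0 (v w n i) := by
  refine (Realizable.relu hv).congr fun w n _ => ?_
  ext p
  refine Fin.cases ?_ (fun i => ?_) p <;> simp

lemma add {u v : VecFamily A} (hu : RealizableVec u) (hv : RealizableVec v) :
    RealizableVec fun w n i => u w n i + v w n i :=
  (hu.linear 1 1 hv).congr fun w n i => by ring

lemma sub {u v : VecFamily A} (hu : RealizableVec u) (hv : RealizableVec v) :
    RealizableVec fun w n i => u w n i - v w n i :=
  (hu.linear 1 (-1) hv).congr fun w n i => by ring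

lemma smul (a : ℝ) {v : VecFamily A} (hv : RealizableVec v) :
    RealizableVec fun w n i => a * v w n i :=
  (hv.linear a 0 hv).congr fun w n i => by ring

lemma one : RealizableVec (A := A) fun _ _ _ => 1 :=
  of_realizable (.const 1) fun _ _ _ => by simp

lemma const (c : ℝ) : RealizableVec (A := A) fun _ _ _ => c :=
  (one.smul c).congr fun _ _ _ => mul_one c

lemma sum {ι : Type*} (s : Finset ι) {v : ι → VecFamily A} (hv : ∀ l, RealizableVec (v l)) :
    RealizableVec fun w n i => ∑ l ∈ s, v l w n i := by
  classical
  induction s using Finset.induction_on with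
  | empty => exact (const 0).congr fun _ _ _ => by simp
  | insert a s ha ih => exact ((hv a).add ih).congr fun _ _ _ => by rw [Finset.sum_insert ha]

open Classical in
lemma symbol (a : Option A) :
    RealizableVec fun w n i => if paddedVector w n i = a then 1 else 0 := by
  refine (of_realizable (.symbol a) fun w n _ => ?_).congr fun w n i => ?_
  · rw [oneHot, if_neg]
    · simp
    · rintro ⟨i, hi, -⟩
      exact (Fin.succ_ne_zero i).symm hi
  · simp [oneHot]

lemma abs_inv_le_one {n : ℕ} (hn : 0 < n) : |-(n : ℝ)⁻¹| ≤ 1 := by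
  have : (1 : ℝ) ≤ n := by exact_mod_cast hn
  rw [abs_neg, abs_of_pos (by positivity)]
  exact inv_le_one_of_one_le₀ this

/-- The position `i`, divided by `n`. -/
lemma position : RealizableVec (A := A) fun _ n i => (i : ℝ) / n := by
  refine (of_realizable (.position 0) fun w n hn => ?_).congr fun w n i => ?_
  · simpa [positionEncoding, neg_div] using abs_inv_le_one hn
  · simp [positionEncoding]

lemma abs_sq_inv_le_one {n : ℕ} (hn : 0 < n) : |(-(n : ℝ)⁻¹) ^ 2| ≤ 1 := by
  rw [abs_pow]
  exact pow_le_one₀ (abs_nonneg _) (abs_inv_le_one hn)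

lemma position_sq : RealizableVec (A := A) fun _ n i => ((i : ℝ) / n) ^ 2 := by
  refine (of_realizable (.position 1) fun w n hn => ?_).congr fun w n i => ?_
  · simpa [positionEncoding, neg_div] using abs_sq_inv_le_one hn
  · simp [positionEncoding]

lemma position_inv : RealizableVec (A := A) fun _ _ i => ((i : ℝ) + 2)⁻¹ := by
  refine (of_realizable (.position 2) fun w n hn => ?_).congr fun w n i => ?_
  · simp [positionEncoding_zero_two]
  · simp [positionEncoding]

/-- The constant `1/n` is found at the default position, where `i/n` is `-1/n`. -/
lemma inv_length : RealizableVec (A := A) fun _ n _ => (n : ℝ)⁻¹ := by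
  refine ((of_realizable (Realizable.position 0).broadcast fun w n hn => ?_).smul (-1)).congr
    fun w n i => ?_
  · simpa [positionEncoding, neg_div] using abs_inv_le_one hn
  · simp [positionEncoding, neg_div]

lemma inv_length_sq : RealizableVec (A := A) fun _ n _ => ((n : ℝ)⁻¹) ^ 2 := by
  refine (of_realizable (Realizable.position 1).broadcast fun w n hn => ?_).congr
    fun w n i => ?_
  · simpa [positionEncoding, neg_div] using abs_sq_inv_le_one hn
  · simp [positionEncoding, neg_div]

end RealizableVec

/-! ### Attention to realizable scores -/

/-- Scores `s(i,j)` that are bilinear in realizable vectors. -/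
def BilinearScore {A : Type*} (s : (w : List A) → (n : ℕ) → Fin n → Fin n → ℝ) : Prop :=
  ∃ (ι : Type) (_ : Fintype ι) (q k : ι → VecFamily A), (∀ l, RealizableVec (q l)) ∧
    (∀ l, RealizableVec (k l)) ∧ ∀ w n i j, s w n i j = ∑ l, q l w n i * k l w n j

namespace BilinearScore

variable {A : Type*}

lemma mul {q k : VecFamily A} (hq : RealizableVec q) (hk : RealizableVec k) :
    BilinearScore fun w n i j => q w n i * k w n j :=
  ⟨Unit, inferInstance, fun _ => q, fun _ => k, fun _ => hq, fun _ => hk, by simp⟩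

lemma add {s t : (w : List A) → (n : ℕ) → Fin n → Fin n → ℝ} (hs : BilinearScore s)
    (ht : BilinearScore t) : BilinearScore fun w n i j => s w n i j + t w n i j := by
  obtain ⟨ι, _, q, k, hq, hk, h⟩ := hs
  obtain ⟨ι', _, q', k', hq', hk', h'⟩ := ht
  exact ⟨ι ⊕ ι', inferInstance, Sum.elim q q', Sum.elim k k', by simp [hq, hq'],
    by simp [hk, hk'], by simp [h, h']⟩

lemma zero : BilinearScore (A := A) fun _ _ _ _ => 0 :=
  ⟨Empty, inferInstance, fun l => l.elim, fun l => l.elim, fun l => l.elim, fun l => l.elim,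
    by simp⟩

end BilinearScore

namespace RealizableVec

variable {A : Type*}

/-- Attention with a bilinear score in which the default position receives the score `t(i)` and
the value `0`. Either the default position wins, or the winners among the other positions agree
on the value. -/
theorem attend (M : Mask) {s : (w : List A) → (n : ℕ) → Fin n → Fin n → ℝ} {t v x : VecFamily A}
    (hs : BilinearScore s) (ht : RealizableVec t) (hv : RealizableVec v)
    (h : ∀ w n i, (x w n i = 0 ∧ ∀ j, M.Allows i.succ j.succ → s w n i j < t w n i) ∨
      (∃ j, M.Allows i.succ j.succ ∧ t w n i < s w n i j) ∧
        ∀ j, M.Allows i.succ j.succ →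
          (∀ j', M.Allows i.succ j'.succ → s w n i j' ≤ s w n i j) → v w n j = x w n i) :
    RealizableVec x := by
  obtain ⟨ι, _, q, k, hq, hk, hs⟩ := hs
  -- The additional products are `t(i)` times the indicator of the default position, and the
  -- latter times itself, which makes the default position attend to nothing but itself.
  refine (Realizable.attention M (ι := ι ⊕ Fin 2)
    (q := Sum.elim (fun l w n => Fin.cons 0 (q l w n))
      ![fun w n => Fin.cons 0 (t w n), fun _ _ p => if p = 0 then 1 else 0])
    (k := Sum.elim (fun l w n => Fin.cons 0 (k l w n))
      ![fun _ _ p => if p = 0 then 1 else 0, fun _ _ p => if p = 0 then 1 else 0])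
    (by
      rintro (l | l)
      · exact hq l
      · fin_cases l
        · exact ht
        · exact .default)
    (by
      rintro (l | l)
      · exact hk l
      · fin_cases l <;> exact .default)
    hv).congr fun w n _ => ?_
  have hallows : ∀ i : Fin n, M.Allows i.succ 0 := by
    intro i
    cases M
    · trivial
    · exact Fin.succ_pos i
    · exact Fin.zero_le _
  ext p
  refine Fin.cases ?_ (fun i => ?_) p
  · by_cases hM : ∃ r, M.Allows (n := n) 0 r
    · have h00 : M.Allows (n := n) 0 0 := by
        cases M
        · trivial
        · obtain ⟨r, hr⟩ := hM
          exact absurd hr (Fin.not_lt_zero r)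
        · exact le_refl (0 : Fin (n + 1))
      refine hardAverage_eq hM fun r _ hr => ?_
      have := hr 0 h00
      by_cases hr0 : r = 0
      · rw [hr0]; rfl
      · simp [hr0] at this
        norm_num at this
    · have : ∀ r, ¬ M.Allows (n := n) 0 r := fun r hr => hM ⟨r, hr⟩
      simp [hardAverage, this]
  · have hj : ∀ j : Fin n, ∑ l : ι, q l w n i * k l w n j = s w n i j := fun j => (hs w n i j).symm
    refine hardAverage_eq ⟨0, hallows i⟩ ?_
    simp only [Fintype.sum_sum_type, Sum.elim_inl, Sum.elim_inr, Fin.sum_univ_two,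
      Matrix.cons_val_zero, Matrix.cons_val_one, Fin.cons_succ, Fin.succ_ne_zero, if_false,
      zero_mul, add_zero]
    have key : ∀ r : Fin (n + 1), ∑ l : ι, q l w n i * (Fin.cons 0 (k l w n) : Fin (n + 1) → ℝ) r
        + t w n i * (if r = 0 then 1 else 0)
        = (Fin.cons (t w n i) (s w n i) : Fin (n + 1) → ℝ) r := by
      intro r
      refine Fin.cases ?_ (fun j => ?_) r
      · simp
      · simp [hj]
    simp only [key]
    intro r
    refine Fin.cases ?_ (fun j => ?_) r
    · intro _ hr
      rcases h w n i with ⟨hx, -⟩ | ⟨⟨j, hj1, hj2⟩, -⟩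
      · exact hx.symm
      · have := hr j.succ hj1
        simp only [Fin.cons_succ, Fin.cons_zero] at this
        linarith
    · intro hM hr
      rcases h w n i with ⟨-, hx⟩ | ⟨-, hx⟩
      · have := hr 0 (hallows i)
        simp only [Fin.cons_succ, Fin.cons_zero] at this
        exact absurd (hx j hM) (not_lt.2 this)
      · exact hx j hM fun j' hj' => by simpa using hr j'.succ hj'

/-- The sign of a vector without zeros. -/
lemma neg_test {a : VecFamily A} (ha : RealizableVec a) (h : ∀ w n i, a w n i ≠ 0) :
    RealizableVec fun w n i => if a w n i < 0 then 1 else 0 := by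
  refine attend .none .zero ha one fun w n i => ?_
  rcases (h w n i).lt_or_gt with h | h
  · exact .inr ⟨⟨i, trivial, h⟩, fun _ _ _ => by simp [h]⟩
  · exact .inl ⟨by simp [h.le], fun _ _ => h⟩

/-- Uniform attention to the positions up to `i`, the default position included, computes means
with denominator `i + 2`. -/
lemma prefix_mean {v : VecFamily A} (hv : RealizableVec v) :
    RealizableVec fun w n i => ((i : ℝ) + 2)⁻¹ * ∑ j ∈ Finset.Iic i, v w n j := by
  classical
  refine (Realizable.attention .future (ι := Empty) (q := fun l => l.elim) (k := fun l => l.elim)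
    (fun l => l.elim) (fun l => l.elim) hv).congr fun w n _ => ?_
  ext p
  simp only [hardAverage, Finset.univ_eq_empty, Finset.sum_empty]
  have hset : (Finset.univ.filter fun r => Mask.future.Allows p r ∧
      ∀ r', Mask.future.Allows p r' → (0 : ℝ) ≤ 0) = Finset.Iic p := by
    ext r
    simp [Mask.Allows]
  refine (by congr! : _ = ((Finset.Iic p).card : ℝ)⁻¹ *
    ∑ r ∈ Finset.Iic p, (Fin.cons 0 (v w n) : Fin (n + 1) → ℝ) r).trans ?_
  refine Fin.cases ?_ (fun i => ?_) p
  · have : Finset.Iic (0 : Fin (n + 1)) = {0} := by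
      ext r; simp
    simp [this]
  · have : Finset.Iic i.succ = insert 0 ((Finset.Iic i).map (Fin.succEmb n)) := by
      ext r
      refine Fin.cases ?_ (fun j => ?_) r <;> simp
    rw [Fin.card_Iic, this, Finset.sum_insert (by simp), Finset.sum_map]
    simp only [Fin.val_succ, Fin.cons_zero, Fin.coe_succEmb, Fin.cons_succ, zero_add]
    push_cast
    ring

/-- Retrieval of the value at position `min x (n - 1)`, for a number `x` given in the form
`α * x / n` with a positive factor `α`. -/
lemma lookup {α β v : VecFamily A} (hα : RealizableVec α) (hβ : RealizableVec β)
    (hv : RealizableVec v) (x : (w : List A) → (n : ℕ) → Fin n → ℕ)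
    (hpos : ∀ w n i, 0 < α w n i) (hx : ∀ w n i, β w n i = α w n i * ((x w n i : ℝ) / n))
    (y : (w : List A) → (n : ℕ) → Fin n → Fin n)
    (hy : ∀ w n i, (y w n i : ℕ) = min (x w n i) (n - 1)) :
    RealizableVec fun w n i => v w n (y w n i) := by
  -- The score is `α/n²` times `2xj - j² = x² - (x - j)²`.
  refine attend .none
    ((BilinearScore.mul (hβ.smul 2) position).add (.mul (hα.smul (-1)) position_sq))
    (const (-1)) hv fun w n i => .inr ⟨⟨⟨0, i.pos⟩, trivial, ?_⟩, fun j _ hj => ?_⟩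
  · norm_num
  · have hn : (0 : ℝ) < n := by exact_mod_cast i.pos
    have hscore : ∀ j : Fin n, 2 * β w n i * ((j : ℝ) / n) + -1 * α w n i * ((j : ℝ) / n) ^ 2
        = α w n i / n ^ 2 * (2 * x w n i * j - (j : ℝ) ^ 2) := by
      intro j
      rw [hx]
      field_simp
      ring
    have := hj (y w n i) trivial
    simp only [hscore] at this
    have hle := le_of_mul_le_mul_left this (div_pos (hpos w n i) (pow_pos hn 2))
    congr 1
    have hjn : (j : ℕ) ≤ n - 1 := Nat.le_sub_one_of_lt j.isLt
    ext
    rcases le_total (x w n i) (n - 1) with hc | hc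
    · rw [hy, min_eq_left hc] at *
      have h0 : ((x w n i : ℝ) - j) ^ 2 ≤ 0 := by nlinarith
      have : (x w n i : ℝ) = j := by nlinarith [sq_nonneg ((x w n i : ℝ) - j)]
      exact_mod_cast this.symm
    · rw [hy, min_eq_right hc] at *
      by_contra hne
      have h1 : (j : ℝ) < (n - 1 : ℕ) := by exact_mod_cast lt_of_le_of_ne hjn hne
      have h2 : ((n - 1 : ℕ) : ℝ) ≤ x w n i := by exact_mod_cast hc
      nlinarith [mul_pos (sub_pos.2 h1) (sub_pos.2 (h1.trans_le h2))]

lemma cast_rev {n : ℕ} (i : Fin n) : ((i.rev : ℕ) : ℝ) / n = 1 - (n : ℝ)⁻¹ - (i : ℝ) / n := by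
  have hn : (n : ℝ) ≠ 0 := by exact_mod_cast i.pos.ne'
  rw [Fin.val_rev, Nat.cast_sub (by omega)]
  push_cast
  field_simp
  ring

/-- Vectors can be reversed. -/
lemma rev {v : VecFamily A} (hv : RealizableVec v) : RealizableVec fun w n i => v w n i.rev :=
  lookup one ((one.sub inv_length).sub position) hv (fun _ _ i => i.rev) (by simp)
    (fun w n i => by rw [cast_rev, one_mul]) (fun _ _ i => i.rev) fun w n i => by
      rw [min_eq_left (Nat.le_sub_one_of_lt i.rev.isLt)]

end RealizableVec

end AHAT

/-! ### Boolean vectors and predicates of two positions -/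

namespace AHAT

/-- The truth value as a real number. -/
def ofBool (b : Bool) : ℝ := bif b then 1 else 0

@[simp] lemma ofBool_true : ofBool true = 1 := rfl
@[simp] lemma ofBool_false : ofBool false = 0 := rfl

/-- A Boolean vector of length `n` for every input string and every vector length `n`. -/
abbrev BoolFamily (A : Type*) : Type _ := (w : List A) → (n : ℕ) → Fin n → Bool

/-- Realizability of a Boolean vector, represented by `0` and `1`. -/
def RealizableBool {A : Type*} (b : BoolFamily A) : Prop :=
  RealizableVec fun w n i => ofBool (b w n i)

namespace RealizableBool

variable {A : Type*}

lemma const (b : Bool) : RealizableBool (A := A) fun _ _ _ => b := RealizableVec.const _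

lemma not {b : BoolFamily A} (hb : RealizableBool b) : RealizableBool fun w n i => !(b w n i) :=
  (RealizableVec.one.sub hb).congr fun w n i => by cases h : b w n i <;> simp [h]

lemma and {b c : BoolFamily A} (hb : RealizableBool b) (hc : RealizableBool c) :
    RealizableBool fun w n i => b w n i && c w n i :=
  ((hb.add hc).sub .one).relu.congr fun w n i => by
    cases h : b w n i <;> cases h' : c w n i <;> norm_num [h, h']

lemma or {b c : BoolFamily A} (hb : RealizableBool b) (hc : RealizableBool c) :
    RealizableBool fun w n i => b w n i || c w n i :=
  (hb.not.and hc.not).not.congr fun w n i => by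
    cases b w n i <;> cases c w n i <;> simp

lemma cond {c : BoolFamily A} {u v : VecFamily A} (hc : RealizableBool c) (hu : RealizableVec u)
    (hv : RealizableVec v) (hu' : ∀ w n i, u w n i ∈ Set.Icc 0 1)
    (hv' : ∀ w n i, v w n i ∈ Set.Icc 0 1) :
    RealizableVec fun w n i => bif c w n i then u w n i else v w n i := by
  refine (((RealizableVec.add hc hu).sub .one).relu.add (hv.sub hc).relu).congr fun w n i => ?_
  have h1 := hu' w n i
  have h2 := hv' w n i
  simp only [Set.mem_Icc] at h1 h2
  cases c w n i
  · simp only [ofBool_false, cond_false]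
    rw [max_eq_left (by linarith), max_eq_right (by linarith)]
    ring
  · simp only [ofBool_true, cond_true]
    rw [max_eq_right (by linarith), max_eq_left (by linarith)]
    ring

end RealizableBool

lemma ofBool_mem_Icc (b : Bool) : ofBool b ∈ Set.Icc (0 : ℝ) 1 := by
  cases b <;> simp

lemma sum_ofBool_eq_and {Δ : Type*} [Fintype Δ] [DecidableEq Δ] (x y : Δ) :
    ∑ a, ofBool (decide (x = a)) * ofBool (decide (y = a)) = ofBool (decide (x = y)) := by
  rw [Finset.sum_eq_single x]
  · simp [eq_comm]
  · intro a _ ha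
    simp [ha.symm]
  · simp

/-- A real value depending on two positions, for every input string and every vector length. -/
abbrev PairFamily (A : Type*) : Type _ := (w : List A) → (n : ℕ) → Fin n → Fin n → ℝ

/-- Linear combinations of products of a realizable Boolean depending on `i` and one depending
on `j`. In contrast to bilinear scores, they are closed under products. -/
def BooleanForm {A : Type*} (s : PairFamily A) : Prop :=
  ∃ (ι : Type) (_ : Fintype ι) (c : ι → ℝ) (a b : ι → BoolFamily A),
    (∀ l, RealizableBool (a l)) ∧ (∀ l, RealizableBool (b l)) ∧
      ∀ w n i j, s w n i j = ∑ l, c l * (ofBool (a l w n i) * ofBool (b l w n j))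

namespace BooleanForm

variable {A : Type*}

lemma congr {s t : PairFamily A} (hs : BooleanForm s) (h : ∀ w n i j, s w n i j = t w n i j) :
    BooleanForm t := by
  obtain ⟨ι, hι, c, a, b, ha, hb, h'⟩ := hs
  exact ⟨ι, hι, c, a, b, ha, hb, fun w n i j => (h w n i j).symm.trans (h' w n i j)⟩

lemma bilinearScore {s : PairFamily A} (hs : BooleanForm s) : BilinearScore s := by
  obtain ⟨ι, hι, c, a, b, ha, hb, h⟩ := hs
  exact ⟨ι, hι, fun l w n i => c l * ofBool (a l w n i), fun l w n j => ofBool (b l w n j),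
    fun l => RealizableVec.smul (c l) (ha l), hb, fun w n i j => by simp only [h, mul_assoc]⟩

lemma left {a : BoolFamily A} (ha : RealizableBool a) :
    BooleanForm fun w n i _ => ofBool (a w n i) :=
  ⟨Unit, inferInstance, fun _ => 1, fun _ => a, fun _ _ _ _ => true, fun _ => ha,
    fun _ => .const true, by simp⟩

lemma right {b : BoolFamily A} (hb : RealizableBool b) :
    BooleanForm fun w n _ j => ofBool (b w n j) :=
  ⟨Unit, inferInstance, fun _ => 1, fun _ _ _ _ => true, fun _ => b, fun _ => .const true,
    fun _ => hb, by simp⟩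

lemma const (b : Bool) : BooleanForm (A := A) fun _ _ _ _ => ofBool b := left (.const b)

lemma linear (x y : ℝ) {s t : PairFamily A} (hs : BooleanForm s) (ht : BooleanForm t) :
    BooleanForm fun w n i j => x * s w n i j + y * t w n i j := by
  obtain ⟨ι, _, c, a, b, ha, hb, h⟩ := hs
  obtain ⟨ι', _, c', a', b', ha', hb', h'⟩ := ht
  refine ⟨ι ⊕ ι', inferInstance, Sum.elim (fun l => x * c l) (fun l => y * c' l), Sum.elim a a',
    Sum.elim b b', by simp [ha, ha'], by simp [hb, hb'], fun w n i j => ?_⟩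
  simp [h, h', Finset.mul_sum, mul_assoc]

lemma mul {s t : PairFamily A} (hs : BooleanForm s) (ht : BooleanForm t) :
    BooleanForm fun w n i j => s w n i j * t w n i j := by
  obtain ⟨ι, _, c, a, b, ha, hb, h⟩ := hs
  obtain ⟨ι', _, c', a', b', ha', hb', h'⟩ := ht
  refine ⟨ι × ι', inferInstance, fun l => c l.1 * c' l.2,
    fun l w n i => a l.1 w n i && a' l.2 w n i, fun l w n i => b l.1 w n i && b' l.2 w n i,
    fun l => (ha _).and (ha' _), fun l => (hb _).and (hb' _), fun w n i j => ?_⟩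
  have hand : ∀ x y, ofBool (x && y) = ofBool x * ofBool y := by
    intro x y
    cases x <;> simp
  simp only [h, h', hand, Fintype.sum_prod_type, Finset.sum_mul_sum]
  exact Finset.sum_congr rfl fun l _ => Finset.sum_congr rfl fun l' _ => by ring

lemma not {b : (w : List A) → (n : ℕ) → Fin n → Fin n → Bool}
    (hb : BooleanForm fun w n i j => ofBool (b w n i j)) :
    BooleanForm fun w n i j => ofBool (!(b w n i j)) :=
  ((const true).linear 1 (-1) hb).congr fun w n i j => by cases b w n i j <;> simp

lemma and {b c : (w : List A) → (n : ℕ) → Fin n → Fin n → Bool}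
    (hb : BooleanForm fun w n i j => ofBool (b w n i j))
    (hc : BooleanForm fun w n i j => ofBool (c w n i j)) :
    BooleanForm fun w n i j => ofBool (b w n i j && c w n i j) :=
  (hb.mul hc).congr fun w n i j => by cases b w n i j <;> simp

lemma or {b c : (w : List A) → (n : ℕ) → Fin n → Fin n → Bool}
    (hb : BooleanForm fun w n i j => ofBool (b w n i j))
    (hc : BooleanForm fun w n i j => ofBool (c w n i j)) :
    BooleanForm fun w n i j => ofBool (b w n i j || c w n i j) :=
  (hb.not.and hc.not).not.congr fun w n i j => by cases b w n i j <;> cases c w n i j <;> simp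

lemma cond {c u v : (w : List A) → (n : ℕ) → Fin n → Fin n → Bool}
    (hc : BooleanForm fun w n i j => ofBool (c w n i j))
    (hu : BooleanForm fun w n i j => ofBool (u w n i j))
    (hv : BooleanForm fun w n i j => ofBool (v w n i j)) :
    BooleanForm fun w n i j => ofBool (bif c w n i j then u w n i j else v w n i j) :=
  ((hc.and hu).or (hc.not.and hv)).congr fun w n i j => by cases c w n i j <;> simp

lemma sum {ι : Type*} (s : Finset ι) {t : ι → PairFamily A} (ht : ∀ l, BooleanForm (t l)) :
    BooleanForm fun w n i j => ∑ l ∈ s, t l w n i j := by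
  classical
  induction s using Finset.induction_on with
  | empty => exact (const false).congr fun _ _ _ _ => by simp
  | insert a s ha ih =>
    exact ((ht a).linear 1 1 ih).congr fun _ _ _ _ => by rw [Finset.sum_insert ha]; ring

end BooleanForm

/-! ### Leftmost and rightmost attention -/

/-- A predicate of two positions that is decided by a bilinear score: the score is `τ(i)` if the
predicate holds, and at most `τ(i) - ε(i)` otherwise, with a positive gap `ε(i)`. -/
def Separable {A : Type*} (S : (w : List A) → (n : ℕ) → Fin n → Fin n → Bool) : Prop :=
  ∃ (s : PairFamily A) (τ ε : VecFamily A), BilinearScore s ∧ RealizableVec τ ∧ RealizableVec ε ∧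
    ∀ w n i j, 0 < ε w n i ∧ (S w n i j = true → s w n i j = τ w n i) ∧
      (S w n i j = false → s w n i j ≤ τ w n i - ε w n i)

lemma Separable.of_booleanForm {A : Type*} {S : (w : List A) → (n : ℕ) → Fin n → Fin n → Bool}
    (hS : BooleanForm fun w n i j => ofBool (S w n i j)) : Separable S :=
  ⟨_, _, _, hS.bilinearScore, .one, .one, fun w n i j => by cases S w n i j <;> simp⟩

/-- Equality of integers `x(i)` and `y(j)` is separable: the score
`2xy - y² = x² - (x - y)²`, divided by `n²`, is `x²/n²` if they are equal, and less by at least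
`1/n²` otherwise. -/
lemma Separable.natEq {A : Type*} {x y : (w : List A) → (n : ℕ) → Fin n → ℕ}
    (hxn : ∀ w n i, x w n i < n) (hyn : ∀ w n i, y w n i < n)
    (hx : RealizableVec fun w n i => (x w n i : ℝ) / n)
    (hy : RealizableVec fun w n i => (y w n i : ℝ) / n) :
    Separable fun w n i j => decide (x w n i = y w n j) := by
  have hsq : ∀ {z : (w : List A) → (n : ℕ) → Fin n → ℕ}, (∀ w n i, z w n i < n) →
      RealizableVec (fun w n i => (z w n i : ℝ) / n) →
      RealizableVec (fun w n i => ((z w n i : ℝ) / n) ^ 2) := fun {z} hzn hz =>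
    RealizableVec.lookup .one hz .position_sq z (by simp) (by simp)
      (fun w n i => ⟨z w n i, hzn w n i⟩)
      fun w n i => (min_eq_left (Nat.le_sub_one_of_lt (hzn w n i))).symm
  refine ⟨_, _, _, (BilinearScore.mul (hx.smul 2) hy).add
    (.mul (RealizableVec.const (-1)) (hsq hyn hy)), hsq hxn hx, .inv_length_sq,
    fun w n i j => ?_⟩
  have hn : (0 : ℝ) < n := by exact_mod_cast i.pos
  refine ⟨by positivity, fun h => ?_, fun h => ?_⟩
  · have h : x w n i = y w n j := by simpa using h
    rw [h]
    ring
  · have h : x w n i ≠ y w n j := by simpa using h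
    have h1 : (1 : ℝ) ≤ ((x w n i : ℝ) - y w n j) ^ 2 := by
      have : (1 : ℤ) ≤ ((x w n i : ℤ) - y w n j) ^ 2 :=
        Int.add_one_le_iff.2 (sq_pos_of_ne_zero (sub_ne_zero.2 (by exact_mod_cast h)))
      exact_mod_cast this
    have h2 : ((n : ℝ)⁻¹) ^ 2 * 1 ≤ ((n : ℝ)⁻¹) ^ 2 * ((x w n i : ℝ) - y w n j) ^ 2 :=
      mul_le_mul_of_nonneg_left h1 (by positivity)
    simp only [div_eq_mul_inv]
    nlinarith

lemma BilinearScore.rev {A : Type*} {s : PairFamily A} (hs : BilinearScore s) :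
    BilinearScore fun w n i j => s w n i.rev j.rev := by
  obtain ⟨ι, hι, q, k, hq, hk, h⟩ := hs
  exact ⟨ι, hι, fun l w n i => q l w n i.rev, fun l w n j => k l w n j.rev,
    fun l => (hq l).rev, fun l => (hk l).rev, fun w n i j => h w n i.rev j.rev⟩

lemma Separable.rev {A : Type*} {S : (w : List A) → (n : ℕ) → Fin n → Fin n → Bool}
    (hS : Separable S) : Separable fun w n i j => S w n i.rev j.rev := by
  obtain ⟨s, τ, ε, hs, hτ, hε, h⟩ := hS
  exact ⟨_, _, _, hs.rev, hτ.rev, hε.rev, fun w n i j => h w n i.rev j.rev⟩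

end AHAT

namespace SRASP

lemma Choice.select_eq_some {n : ℕ} {c : Choice} {s : Finset (Fin n)} {j : Fin n} :
    c.select s = some j ↔ j ∈ s ∧ ∀ j' ∈ s, match c with
      | .leftmost => j ≤ j'
      | .rightmost => j' ≤ j := by
  unfold Choice.select
  split_ifs with h
  · cases c
    · simp only [Option.some_inj]
      refine ⟨?_, fun ⟨h1, h2⟩ => le_antisymm (s.min'_le j h1) (h2 _ (s.min'_mem h))⟩
      rintro rfl
      exact ⟨s.min'_mem h, fun j' hj' => s.min'_le j' hj'⟩
    · simp only [Option.some_inj]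
      refine ⟨?_, fun ⟨h1, h2⟩ => le_antisymm (h2 _ (s.max'_mem h)) (s.le_max' j h1)⟩
      rintro rfl
      exact ⟨s.max'_mem h, fun j' hj' => s.le_max' j' hj'⟩
  · simp only [false_iff]
    exact fun ⟨h1, _⟩ => h ⟨j, h1⟩

lemma Choice.select_eq_none {n : ℕ} {c : Choice} {s : Finset (Fin n)} :
    c.select s = none ↔ s = ∅ := by
  unfold Choice.select
  split_ifs with h
  · cases c <;> simp [h.ne_empty]
  · simpa using h

/-- The choice in the opposite direction. -/
def Choice.flip : Choice → Choice
  | .leftmost => .rightmost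
  | .rightmost => .leftmost

lemma Choice.select_rev {n : ℕ} (c : Choice) (p : Fin n → Prop) [DecidablePred p] :
    c.select (Finset.univ.filter p)
      = (c.flip.select (Finset.univ.filter fun j => p j.rev)).map Fin.rev := by
  ext j
  rw [Option.map_eq_some_iff, Choice.select_eq_some]
  simp only [Choice.select_eq_some, Finset.mem_filter, Finset.mem_univ, true_and]
  constructor
  · rintro ⟨hj, h⟩
    refine ⟨j.rev, ⟨by simpa using hj, fun j' hj' => ?_⟩, Fin.rev_rev j⟩
    cases c <;> simpa [Choice.flip, Fin.le_rev_iff, Fin.rev_le_iff] using h _ hj'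
  · rintro ⟨k, ⟨hk, h⟩, rfl⟩
    refine ⟨hk, fun j' hj' => ?_⟩
    have := h j'.rev (by simpa using hj')
    cases c <;> simpa [Choice.flip, Fin.le_rev_iff, Fin.rev_le_iff] using this

end SRASP

namespace AHAT

open SRASP (Choice)

/-- The position selected from the positions `j` satisfying the mask `M(i,j)` and the
predicate `S(i,j)`. -/
def selected {n : ℕ} (c : Choice) (M : SRASP.Mask) (S : Fin n → Fin n → Bool) (i : Fin n) :
    Option (Fin n) :=
  c.select (Finset.univ.filter fun j => M.eval i j = true ∧ S i j = true)

/-- A multiple of `j/n` that is smaller than the gap of a separable predicate breaks ties towards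
the left or the right. The default position is given a score halfway in the gap, so that it wins
if and only if there is no candidate. -/
lemma Separable.attend {A : Type*} {S : (w : List A) → (n : ℕ) → Fin n → Fin n → Bool}
    (hS : Separable S) {v : VecFamily A} (hv : RealizableVec v) (c : Choice) (M : Mask)
    (M' : SRASP.Mask)
    (hM : ∀ (n : ℕ) (i j : Fin n), M.Allows i.succ j.succ ↔ M'.eval i j = true) :
    RealizableVec fun w n i => (selected c M' (S w n) i).elim 0 (v w n) := by
  obtain ⟨s, τ, ε, hs, hτ, hε, h⟩ := hS
  obtain ⟨σ, hσ, hσ1⟩ : ∃ σ : ℝ, (σ = match c with | .leftmost => -1 | .rightmost => 1) ∧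
      |σ| = 1 := by
    cases c
    · exact ⟨-1, rfl, by simp⟩
    · exact ⟨1, rfl, by simp⟩
  refine RealizableVec.attend M (hs.add (.mul (hε.smul (σ / 4)) .position))
    (hτ.linear 1 (-(1 / 2)) hε) hv fun w n i => ?_
  have hn : (0 : ℝ) < n := by exact_mod_cast i.pos
  have htie : ∀ j : Fin n, |σ / 4 * ε w n i * ((j : ℝ) / n)| ≤ ε w n i / 4 := by
    intro j
    have hj1 : (j : ℝ) / n ≤ 1 := (div_le_one hn).2 (by exact_mod_cast j.isLt.le)
    have hj0 : 0 ≤ (j : ℝ) / n := by positivity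
    rw [abs_mul, abs_mul, abs_div, hσ1, abs_of_pos (h w n i j).1, abs_of_nonneg hj0,
      abs_of_pos (by norm_num : (0 : ℝ) < 4)]
    nlinarith [(h w n i j).1]
  have htrue : ∀ j, S w n i j = true → τ w n i - ε w n i / 2 <
      s w n i j + σ / 4 * ε w n i * ((j : ℝ) / n) := by
    intro j hj
    have := (abs_le.1 (htie j)).1
    rw [(h w n i j).2.1 hj]
    linarith [(h w n i j).1]
  have hfalse : ∀ j, S w n i j = false → s w n i j + σ / 4 * ε w n i * ((j : ℝ) / n) <
      τ w n i - ε w n i / 2 := by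
    intro j hj
    have := (abs_le.1 (htie j)).2
    linarith [(h w n i j).1, (h w n i j).2.2 hj]
  have ht : 1 * τ w n i + -(1 / 2) * ε w n i = τ w n i - ε w n i / 2 := by ring
  rw [ht]
  rcases hsel : selected c M' (S w n) i with _ | j₀
  · refine .inl ⟨rfl, fun j hj => hfalse j ?_⟩
    have := Choice.select_eq_none.1 hsel
    rw [Finset.filter_eq_empty_iff] at this
    have := this (Finset.mem_univ j)
    rw [← hM] at this
    simpa [hj] using this
  · obtain ⟨hj₀, hopt⟩ := Choice.select_eq_some.1 hsel
    simp only [Finset.mem_filter, Finset.mem_univ, true_and, ← hM] at hj₀ hopt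
    refine .inr ⟨⟨j₀, hj₀.1, htrue j₀ hj₀.2⟩, fun j hj hmax => ?_⟩
    have hle := hmax j₀ hj₀.1
    have hSj : S w n i j = true := by
      by_contra hc
      have := hfalse j (by simpa using hc)
      linarith [htrue j₀ hj₀.2]
    rw [(h w n i j).2.1 hSj, (h w n i j₀).2.1 hj₀.2] at hle
    have hε0 := (h w n i j).1
    have hle' : σ * (j₀ : ℝ) ≤ σ * j := by
      have h4 : 0 < ε w n i / (4 * n) := by positivity
      refine le_of_mul_le_mul_left ?_ h4
      calc ε w n i / (4 * n) * (σ * j₀) = σ / 4 * ε w n i * ((j₀ : ℝ) / n) := by ring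
        _ ≤ σ / 4 * ε w n i * ((j : ℝ) / n) := by linarith
        _ = ε w n i / (4 * n) * (σ * j) := by ring
    have hopt := hopt j ⟨hj, hSj⟩
    have : j = j₀ := by
      cases c
      · simp only at hσ hopt
        rw [hσ] at hle'
        have : (j : ℝ) ≤ j₀ := by linarith
        exact le_antisymm (by exact_mod_cast this) hopt
      · simp only at hσ hopt
        rw [hσ] at hle'
        have : (j₀ : ℝ) ≤ j := by linarith
        exact le_antisymm hopt (by exact_mod_cast this)
    rw [this]
    rfl

/-- Attention with a past mask, which transformers lack, is attention with a future mask on the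
reversed vectors, the result being reversed again. -/
lemma Separable.attend_rev {A : Type*} {S : (w : List A) → (n : ℕ) → Fin n → Fin n → Bool}
    (hS : Separable S) {v : VecFamily A} (hv : RealizableVec v) (c : Choice) (M : Mask)
    (M' : SRASP.Mask)
    (hM : ∀ (n : ℕ) (i j : Fin n), M.Allows i.succ j.succ ↔ M'.eval i.rev j.rev = true) :
    RealizableVec fun w n i => (selected c M' (S w n) i).elim 0 (v w n) := by
  obtain ⟨M'', hM''⟩ : ∃ M'' : SRASP.Mask, ∀ (n : ℕ) (i j : Fin n),
      M''.eval i j = M'.eval i.rev j.rev := by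
    cases M'
    · exact ⟨.none, fun n i j => rfl⟩
    · exact ⟨.strictPast, fun n i j => by simp [SRASP.Mask.eval]⟩
    · exact ⟨.past, fun n i j => by simp [SRASP.Mask.eval]⟩
    · exact ⟨.strictFuture, fun n i j => by simp [SRASP.Mask.eval]⟩
    · exact ⟨.future, fun n i j => by simp [SRASP.Mask.eval]⟩
  refine (hS.rev.attend hv.rev c.flip M M'' fun n i j => by rw [hM, hM'']).rev.congr
    fun w n i => ?_
  have : selected c M' (S w n) i =
      (selected c.flip M'' (fun i j => S w n i.rev j.rev) i.rev).map Fin.rev := by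
    simp only [selected, hM'', Fin.rev_rev]
    exact Choice.select_rev c _
  rw [this]
  cases selected c.flip M'' (fun i j => S w n i.rev j.rev) i.rev <;> rfl

/-- Leftmost or rightmost attention of S-RASP with any mask, and with values and defaults in
`[0, 1]`. -/
theorem Separable.attend_default {A : Type*}
    {S : (w : List A) → (n : ℕ) → Fin n → Fin n → Bool} (hS : Separable S) (c : Choice)
    (M : SRASP.Mask) {v d : VecFamily A} (hv : RealizableVec v) (hd : RealizableVec d)
    (hd' : ∀ w n i, d w n i ∈ Set.Icc 0 1) :
    RealizableVec fun w n i => (selected c M (S w n) i).elim (d w n i) (v w n) := by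
  have key : ∀ {v : VecFamily A}, RealizableVec v →
      RealizableVec fun w n i => (selected c M (S w n) i).elim 0 (v w n) := by
    intro v hv
    cases M
    · exact hS.attend hv c .none _ fun n i j => by simp [SRASP.Mask.eval, Mask.Allows]
    · exact hS.attend hv c .strictFuture _ fun n i j => by simp [SRASP.Mask.eval, Mask.Allows]
    · exact hS.attend hv c .future _ fun n i j => by simp [SRASP.Mask.eval, Mask.Allows]
    · exact hS.attend_rev hv c .strictFuture _ fun n i j => by
        simp [SRASP.Mask.eval, Mask.Allows]
    · exact hS.attend_rev hv c .future _ fun n i j => by simp [SRASP.Mask.eval, Mask.Allows]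
  -- The value `1` tells whether a position is selected.
  refine ((key hv).add (hd.sub (key .one)).relu).congr fun w n i => ?_
  have := hd' w n i
  simp only [Set.mem_Icc] at this
  cases selected c M (S w n) i
  · simp [this.1]
  · simp [this.2]

end AHAT

/-! ### Values and expressions of S-RASP -/

namespace AHAT

open SRASP

variable {A : Type*} {Δ : Type} [DecidableEq Δ]

/-- Realizability of a vector of S-RASP values: Booleans are represented by `0` and `1`, symbols
by one-hot vectors, and integers, which have to be less than `n`, are divided by `n`. -/
def RealizableVal : (τ : Ty) → ((w : List A) → (n : ℕ) → Fin n → τ.Val Δ) → Prop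
  | .bool, v => RealizableBool v
  | .sym, v => ∀ a, RealizableBool fun w n i => decide (v w n i = a)
  | .nat, v => (∀ w n i, v w n i < n) ∧ RealizableVec fun w n i => (v w n i : ℝ) / n

/-- The counterpart of `RealizableVal` for values depending on two positions. Nothing is required
of integers, which enter predicates only through comparisons. -/
def PairRealizable : (τ : Ty) → ((w : List A) → (n : ℕ) → Fin n → Fin n → τ.Val Δ) → Prop
  | .bool, v => BooleanForm fun w n i j => ofBool (v w n i j)
  | .sym, v => ∀ a, BooleanForm fun w n i j => ofBool (decide (v w n i j = a))
  | .nat, _ => True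

lemma div_length_mem_Icc {n x : ℕ} (h : x < n) : (x : ℝ) / n ∈ Set.Icc (0 : ℝ) 1 := by
  have hn : (0 : ℝ) < n := by exact_mod_cast (Nat.zero_le x).trans_lt h
  exact ⟨by positivity, (div_le_one hn).2 (by exact_mod_cast h.le)⟩

lemma RealizableVal.cond {τ : Ty} {c : BoolFamily A}
    {u v : (w : List A) → (n : ℕ) → Fin n → τ.Val Δ} (hc : RealizableBool c)
    (hu : RealizableVal τ u) (hv : RealizableVal τ v) :
    RealizableVal τ fun w n i => bif c w n i then u w n i else v w n i := by
  cases τ with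
  | bool =>
    exact (hc.cond hu hv (fun _ _ _ => ofBool_mem_Icc _) fun _ _ _ => ofBool_mem_Icc _).congr
      fun w n i => by beta_reduce; cases c w n i <;> rfl
  | sym =>
    exact fun a => (hc.cond (hu a) (hv a) (fun _ _ _ => ofBool_mem_Icc _)
      fun _ _ _ => ofBool_mem_Icc _).congr fun w n i => by beta_reduce; cases c w n i <;> rfl
  | nat =>
    refine ⟨fun w n i => ?_, (hc.cond hu.2 hv.2 (fun w n i => div_length_mem_Icc (hu.1 w n i))
      fun w n i => div_length_mem_Icc (hv.1 w n i)).congr fun w n i => by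
        beta_reduce; cases c w n i <;> rfl⟩
    beta_reduce
    cases c w n i
    · exact hv.1 w n i
    · exact hu.1 w n i

lemma RealizableVal.attend {τ : Ty} {S : (w : List A) → (n : ℕ) → Fin n → Fin n → Bool}
    (hS : Separable S) (c : Choice) (M : SRASP.Mask)
    {v d : (w : List A) → (n : ℕ) → Fin n → τ.Val Δ}
    (hv : RealizableVal τ v) (hd : RealizableVal τ d) :
    RealizableVal τ fun w n i => (selected c M (S w n) i).elim (d w n i) (v w n) := by
  cases τ with
  | bool =>
    exact (hS.attend_default c M hv hd fun _ _ _ => ofBool_mem_Icc _).congr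
      fun w n i => by beta_reduce; cases selected c M (S w n) i <;> rfl
  | sym =>
    exact fun a => (hS.attend_default c M (hv a) (hd a) fun _ _ _ => ofBool_mem_Icc _).congr
      fun w n i => by beta_reduce; cases selected c M (S w n) i <;> rfl
  | nat =>
    refine ⟨fun w n i => ?_, (hS.attend_default c M hv.2 hd.2
      fun w n i => div_length_mem_Icc (hd.1 w n i)).congr fun w n i => by
        beta_reduce; cases selected c M (S w n) i <;> rfl⟩
    beta_reduce
    cases selected c M (S w n) i
    · exact hd.1 w n i
    · exact hv.1 w n _

/-- Integers can be compared: `x ≤ y` if and only if `x/n - y/n - 1/(2n)` is negative, and this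
number is never zero. -/
lemma RealizableVal.le {x y : (w : List A) → (n : ℕ) → Fin n → ℕ}
    (hx : RealizableVal (Δ := Δ) .nat x) (hy : RealizableVal (Δ := Δ) .nat y) :
    RealizableBool fun w n i => decide (x w n i ≤ y w n i) := by
  have key : ∀ (w : List A) (n : ℕ) (i : Fin n),
      1 * ((x w n i : ℝ) / n - (y w n i : ℝ) / n) + -(1 / 2) * (n : ℝ)⁻¹
        = ((x w n i : ℝ) - y w n i - 1 / 2) / n := fun w n i => by ring
  have hpos : ∀ {n : ℕ} (_ : Fin n), (0 : ℝ) < n := fun i => by exact_mod_cast i.pos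
  refine (((hx.2.sub hy.2).linear 1 (-(1 / 2)) .inv_length).neg_test fun w n i => ?_).congr
    fun w n i => ?_
  · rw [key]
    refine div_ne_zero (fun h => ?_) (hpos i).ne'
    have h2 : (2 * x w n i : ℝ) = 2 * y w n i + 1 := by linarith
    have h2 : 2 * x w n i = 2 * y w n i + 1 := by exact_mod_cast h2
    omega
  · rw [key]
    by_cases h : x w n i ≤ y w n i
    · have : (x w n i : ℝ) ≤ y w n i := by exact_mod_cast h
      rw [if_pos (div_neg_of_neg_of_pos (by linarith) (hpos i))]
      simp [h]
    · have : (y w n i : ℝ) + 1 ≤ x w n i := by exact_mod_cast not_le.1 h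
      rw [if_neg (not_lt.2 (div_nonneg (by linarith) (hpos i).le))]
      simp [h]

lemma RealizableVal.cmp (op : Cmp) {x y : (w : List A) → (n : ℕ) → Fin n → ℕ}
    (hx : RealizableVal (Δ := Δ) .nat x) (hy : RealizableVal (Δ := Δ) .nat y) :
    RealizableBool fun w n i => op.eval (x w n i) (y w n i) := by
  have hxy := hx.le hy
  have hyx := hy.le hx
  cases op with
  | eq =>
    refine (hxy.and hyx).congr fun w n i => congrArg ofBool ?_
    beta_reduce
    rw [← Bool.decide_and]
    exact decide_eq_decide.2 le_antisymm_iff.symm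
  | ne =>
    refine (hxy.and hyx).not.congr fun w n i => congrArg ofBool ?_
    beta_reduce
    rw [← Bool.decide_and, ← decide_not]
    exact decide_eq_decide.2 (not_congr le_antisymm_iff.symm)
  | lt =>
    refine hyx.not.congr fun w n i => congrArg ofBool ?_
    beta_reduce
    rw [← decide_not]
    exact decide_eq_decide.2 not_le
  | le => exact hxy
  | gt =>
    refine hxy.not.congr fun w n i => congrArg ofBool ?_
    beta_reduce
    rw [← decide_not]
    exact decide_eq_decide.2 not_le
  | ge => exact hyx

lemma RealizableVal.zero : RealizableVal (A := A) (Δ := Δ) .nat fun _ _ _ => (0 : ℕ) :=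
  ⟨fun _ _ i => i.pos, (RealizableVec.const 0).congr fun _ _ _ => by simp⟩

/-- A real vector that is `x/n` can be clipped to `min x (n - 1) / n`. -/
lemma RealizableVal.clip {x : (w : List A) → (n : ℕ) → Fin n → ℕ}
    (hx : RealizableVec fun w n i => (x w n i : ℝ) / n) :
    RealizableVal (Δ := Δ) .nat fun w n i => min (x w n i) (n - 1) := by
  refine ⟨fun w n i => lt_of_le_of_lt (Nat.min_le_right _ _) (Nat.sub_one_lt i.pos.ne'),
    (hx.sub (hx.sub (RealizableVec.one.sub .inv_length)).relu).congr fun w n i => ?_⟩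
  have hn : (0 : ℝ) < n := by exact_mod_cast i.pos
  have h1 : (1 : ℝ) - (n : ℝ)⁻¹ = ((n - 1 : ℕ) : ℝ) / n := by
    rw [Nat.cast_sub i.pos]
    field_simp
    simp
  rw [h1]
  beta_reduce
  rcases le_total (x w n i) (n - 1) with h | h
  · have : (x w n i : ℝ) / n ≤ ((n - 1 : ℕ) : ℝ) / n := by gcongr
    rw [min_eq_left h, max_eq_left (by linarith), sub_zero]
  · have : ((n - 1 : ℕ) : ℝ) / n ≤ (x w n i : ℝ) / n := by gcongr
    rw [min_eq_right h, max_eq_right (by linarith)]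
    ring

lemma RealizableVal.prefixSum {x : (w : List A) → (n : ℕ) → Fin n → ℕ}
    (hx : RealizableVal (Δ := Δ) .nat x) :
    RealizableVal (Δ := Δ) .nat
      fun w n i => min (∑ j ∈ Finset.Iic i, x w n j) (n - 1) := by
  have hlt : ∀ (w : List A) (n : ℕ) (i : Fin n),
      min (∑ j ∈ Finset.Iic i, x w n j) (n - 1) < n := fun w n i => by have := i.pos; omega
  -- The mean of `x/n` over `-1, ..., i` is the sum over `j ≤ i` times the known factor `1/(i+2)`.
  refine ⟨hlt, RealizableVec.lookup .position_inv hx.2.prefix_mean .position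
    (fun w n i => ∑ j ∈ Finset.Iic i, x w n j) (fun w n i => by positivity)
    (fun w n i => ?_) (fun w n i => ⟨_, hlt w n i⟩) fun _ _ _ => rfl⟩
  push_cast
  rw [Finset.sum_div]

/-- All vectors declared in a context are realizable. -/
def RealizableEnv {ctx : List Ty} (ρ : (w : List A) → (n : ℕ) → Env Δ n ctx) : Prop :=
  ∀ τ (P : Vec ctx τ), RealizableVal τ fun w n => ρ w n τ P

lemma RealizableVal.expr [Fintype Δ] {ctx : List Ty} {ρ : (w : List A) → (n : ℕ) → Env Δ n ctx}
    (hρ : RealizableEnv ρ) {τ : Ty} (e : Expr Δ ctx τ) :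
    RealizableVal τ fun w n i => e.eval (ρ w n) i i := by
  induction e with
  | vec P x => cases x <;> exact hρ _ P
  | ite e₁ c e₂ ih₁ ihc ih₂ => exact RealizableVal.cond ihc ih₁ ih₂
  | top => exact RealizableBool.const true
  | bot => exact RealizableBool.const false
  | and e₁ e₂ ih₁ ih₂ => exact RealizableBool.and ih₁ ih₂
  | or e₁ e₂ ih₁ ih₂ => exact RealizableBool.or ih₁ ih₂
  | not e ih => exact RealizableBool.not ih
  | symEq e₁ e₂ ih₁ ih₂ =>
    refine (RealizableVec.sum Finset.univ fun a => (ih₁ a).and (ih₂ a)).congr fun w n i => ?_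
    refine Eq.trans ?_ (sum_ofBool_eq_and (e₁.eval (ρ w n) i i) (e₂.eval (ρ w n) i i))
    refine Finset.sum_congr rfl fun a _ => ?_
    beta_reduce
    cases decide (e₁.eval (ρ w n) i i = a) <;> simp
  | cmp op e₁ e₂ ih₁ ih₂ => exact RealizableVal.cmp op ih₁ ih₂
  | sym a => exact fun b => RealizableBool.const (decide (a = b))
  | zero => exact RealizableVal.zero
  | one =>
    exact RealizableVal.clip (x := fun _ _ _ => 1)
      (RealizableVec.inv_length.congr fun _ _ _ => by simp)
  | add e₁ e₂ ih₁ ih₂ =>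
    exact RealizableVal.clip
      (x := fun w n i => (e₁.eval (ρ w n) i i : ℕ) + (e₂.eval (ρ w n) i i : ℕ))
      ((ih₁.2.add ih₂.2).congr fun _ _ _ => by push_cast; ring)
  | sub e₁ e₂ ih₁ ih₂ =>
    refine ⟨fun w n i => (Nat.sub_le _ _).trans_lt (ih₁.1 w n i),
      (ih₁.2.sub ih₂.2).relu.congr fun w n i => ?_⟩
    show max 0 (((e₁.eval (ρ w n) i i : ℕ) : ℝ) / n - ((e₂.eval (ρ w n) i i : ℕ) : ℝ) / n)
      = (((e₁.eval (ρ w n) i i : ℕ) - (e₂.eval (ρ w n) i i : ℕ) : ℕ) : ℝ) / n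
    generalize (e₁.eval (ρ w n) i i : ℕ) = x
    generalize (e₂.eval (ρ w n) i i : ℕ) = y
    rw [← sub_div]
    rcases le_total y x with h | h
    · have : (y : ℝ) ≤ x := by exact_mod_cast h
      rw [Nat.cast_sub h, max_eq_right (div_nonneg (by linarith) n.cast_nonneg)]
    · have : (x : ℝ) ≤ y := by exact_mod_cast h
      rw [Nat.sub_eq_zero_of_le h,
        max_eq_left (div_nonpos_of_nonpos_of_nonneg (by linarith) n.cast_nonneg)]
      simp

/-- The value of an expression depends only on the variables that occur in it. -/
lemma eval_congr {n : ℕ} {ctx : List Ty} (ρ : Env Δ n ctx) {τ : Ty} (e : Expr Δ ctx τ)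
    {i j i' j' : Fin n} (hi : PVar.i ∈ e.FV → i = i') (hj : PVar.j ∈ e.FV → j = j') :
    e.eval ρ i j = e.eval ρ i' j' := by
  induction e with
  | vec P x =>
    cases x
    · rw [hi rfl]; rfl
    · rw [hj rfl]; rfl
  | ite e₁ c e₂ ih₁ ihc ih₂ =>
    simp only [Expr.eval]
    rw [ih₁ (fun h => hi (.inl (.inl h))) (fun h => hj (.inl (.inl h))),
      ihc (fun h => hi (.inl (.inr h))) (fun h => hj (.inl (.inr h))),
      ih₂ (fun h => hi (.inr h)) (fun h => hj (.inr h))]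
  | top | bot | sym a | zero | one => rfl
  | and e₁ e₂ ih₁ ih₂ | or e₁ e₂ ih₁ ih₂ | symEq e₁ e₂ ih₁ ih₂ | cmp op e₁ e₂ ih₁ ih₂
  | add e₁ e₂ ih₁ ih₂ | sub e₁ e₂ ih₁ ih₂ =>
    simp only [Expr.eval]
    rw [ih₁ (fun h => hi (.inl h)) (fun h => hj (.inl h)),
      ih₂ (fun h => hi (.inr h)) (fun h => hj (.inr h))]
  | not e ih =>
    simp only [Expr.eval]
    rw [ih hi hj]

lemma decide_cond_eq (c : Bool) (x y a : Δ) :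
    decide ((bif c then x else y) = a) = bif c then decide (x = a) else decide (y = a) := by
  cases c <;> rfl

lemma PairRealizable.expr [Fintype Δ] {ctx : List Ty}
    {ρ : (w : List A) → (n : ℕ) → Env Δ n ctx} (hρ : RealizableEnv ρ) {τ : Ty}
    (e : Expr Δ ctx τ) (he : e.UnaryComparisons) :
    PairRealizable τ fun w n i j => e.eval (ρ w n) i j := by
  induction e with
  | @vec τ P x =>
    have hP := hρ _ P
    cases τ with
    | bool =>
      cases x
      · exact BooleanForm.left hP
      · exact BooleanForm.right hP
    | sym =>
      intro a
      cases x
      · exact BooleanForm.left (hP a)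
      · exact BooleanForm.right (hP a)
    | nat => trivial
  | @ite τ e₁ c e₂ ih₁ ihc ih₂ =>
    have h₁ := ih₁ he.1
    have hc := ihc he.2.1
    have h₂ := ih₂ he.2.2
    cases τ with
    | bool => exact BooleanForm.cond hc h₁ h₂
    | sym =>
      exact fun a => (BooleanForm.cond hc (h₁ a) (h₂ a)).congr fun w n i j =>
        congrArg ofBool (decide_cond_eq _ _ _ _).symm
    | nat => trivial
  | top => exact BooleanForm.const true
  | bot => exact BooleanForm.const false
  | and e₁ e₂ ih₁ ih₂ => exact BooleanForm.and (ih₁ he.1) (ih₂ he.2)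
  | or e₁ e₂ ih₁ ih₂ => exact BooleanForm.or (ih₁ he.1) (ih₂ he.2)
  | not e ih => exact BooleanForm.not (ih he)
  | symEq e₁ e₂ ih₁ ih₂ =>
    exact (BooleanForm.sum Finset.univ fun a => (ih₁ he.1 a).mul (ih₂ he.2 a)).congr
      fun w n i j => sum_ofBool_eq_and _ _
  | cmp op e₁ e₂ ih₁ ih₂ =>
    have hcmp := RealizableVal.expr hρ (Expr.cmp op e₁ e₂)
    by_cases h : PVar.j ∈ (Expr.cmp op e₁ e₂).FV
    · have hi : PVar.i ∉ (Expr.cmp op e₁ e₂).FV := fun hi => nomatch he.1 hi h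
      exact (BooleanForm.right hcmp).congr fun w n i j =>
        congrArg ofBool (eval_congr _ _ (fun h => absurd h hi) fun _ => rfl)
    · exact (BooleanForm.left hcmp).congr fun w n i j =>
        congrArg ofBool (eval_congr _ _ (fun _ => rfl) fun h' => absurd h' h)
  | sym a => exact fun b => BooleanForm.const (decide (a = b))
  | zero | one | add | sub => trivial

lemma Separable.attnPred [Fintype Δ] {ctx : List Ty}
    {ρ : (w : List A) → (n : ℕ) → Env Δ n ctx} (hρ : RealizableEnv ρ) (S : AttnPred Δ ctx) :
    Separable fun w n i j => S.eval (ρ w n) i j := by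
  cases S with
  | expr e he => exact .of_booleanForm (PairRealizable.expr hρ e he)
  | natEq V₁ V₂ =>
    exact .natEq (hρ _ V₁).1 (hρ _ V₂).1 (hρ _ V₁).2 (hρ _ V₂).2

/-! ### Definitions and programs of S-RASP -/

lemma RealizableVal.rhs [Fintype Δ] {ctx : List Ty}
    {ρ : (w : List A) → (n : ℕ) → Env Δ n ctx} (hρ : RealizableEnv ρ) {τ : Ty}
    (r : Rhs Δ ctx τ) : RealizableVal τ fun w n i => r.eval (ρ w n) i := by
  cases r with
  | pointwise e _ => exact .expr hρ e
  | attention c M S V _ D _ =>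
    have h := RealizableVal.attend (.attnPred hρ S) c M (.expr hρ V) (.expr hρ D)
    have heq : (fun w n i => (Rhs.attention c M S V ‹_› D ‹_›).eval (ρ w n) i) =
        fun (w : List A) n i => (selected c M (fun i j => S.eval (ρ w n) i j) i).elim
          (D.eval (ρ w n) i i) fun j => V.eval (ρ w n) j j := by
      funext w n i
      simp only [Rhs.eval, selected]
      split <;> rename_i h <;> rw [h] <;> rfl
    exact heq ▸ h
  | prefixSum V _ => exact RealizableVal.prefixSum (.expr hρ V)

theorem RealizableEnv.run [Fintype Δ] {input : (w : List A) → (n : ℕ) → Fin n → Δ}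
    (hinput : RealizableVal .sym input) {ctx : List Ty} (c : Code Δ ctx) :
    RealizableEnv fun w n => c.run (input w n) := by
  induction c with
  | start =>
    intro τ P
    cases P with
    | here => exact hinput
    | there P =>
      cases P with
      | here => exact ⟨fun _ _ i => i.isLt, .position⟩
      | there P => nomatch P
  | define c r ih =>
    intro τ P
    cases P with
    | here => exact .rhs ih r
    | there P => exact ih _ P

/-- The input symbols, represented in the working alphabet, are realizable. -/
lemma RealizableVal.input (e : Option A ↪ Δ) :
    RealizableVal .sym fun (w : List A) n i => e (paddedVector w n i) := by
  classical
  intro a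
  by_cases h : ∃ x, e x = a
  · obtain ⟨x, rfl⟩ := h
    refine (RealizableVec.symbol x).congr fun w n i => ?_
    by_cases hx : paddedVector w n i = x <;> simp [hx]
  · refine (RealizableVec.const 0).congr fun w n i => ?_
    have : e (paddedVector w n i) ≠ a := fun h' => h ⟨_, h'⟩
    simp [this]

end AHAT

theorem mainTheorem5 {A B : Type*} [Fintype A] [Fintype B] (f : List A → List B) (q : ℕ → ℕ)
    (P : SRASP.Program A B) (hP : P.Computes f q) :
    ∃ T : AHAT.Encoder A B, T.Computes f q := by
  let _ := P.decEq
  let _ := P.fin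
  have hrun := AHAT.RealizableEnv.run (.input P.inSym) P.code
  obtain ⟨T, hT⟩ := AHAT.exists_encoder_of_realizable _ fun b => hrun .sym P.out (P.outSym b)
  refine ⟨T, hP.1, fun w => ⟨(hP.2 w).1, fun n hn hq p b => ?_⟩⟩
  rw [hT w n (Nat.zero_lt_of_lt hn)]
  refine Fin.cases ?_ (fun i => ?_) p
  · rw [AHAT.oneHot, if_neg]
    · rfl
    · rintro ⟨i, hi, -⟩
      exact (Fin.succ_ne_zero i).symm hi
  · have hout : (P.code.run fun i => P.inSym (paddedVector w n i)) .sym P.out i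
        = P.outSym (paddedVector (f w) n i) := (hP.2 w).2 n hn hq i
    have hb : P.outSym (paddedVector (f w) n i) = P.outSym b ↔ paddedVector (f w) n i = b :=
      P.outSym.injective.eq_iff
    show AHAT.ofBool (decide ((P.code.run fun i => P.inSym (paddedVector w n i)) .sym P.out i
      = P.outSym b)) = _
    rw [hout]
    by_cases h : paddedVector (f w) n i = b
    · rw [decide_eq_true (hb.2 h)]
      simp [AHAT.oneHot, h]
    · rw [decide_eq_false (mt hb.1 h)]
      simp [AHAT.oneHot, h]
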